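/- **Setting.** An acyclic directed mixed graph (ADMG) $\mathcal G$ on a finite vertex set $V$ consists of a directed acyclic graph on $V$ (edges $v\to w$) together with a set of unordered pairs of distinct vertices (edges $v\leftrightarrow w$). Write $\mathrm{an}(W)$ for the set of ancestors of elements of $W$ (including $W$), $\mathrm{pa}(W)$ for the set of their parents, and $\mathrm{dis}_A(W)$ for the set of vertices joined to an element of $W\subseteq A$ by a (possibly empty) path of $\leftrightarrow$ edges inside $A$. A path (with no repeated vertex) is blocked by $C\subseteq V$ if some non-collider on it is in $C$ or some collider on it is not in $\mathrm{an}(C)$; disjoint sets $A,B$ are m-separated given $C\subseteq V\setminus(A\cup B)$ if every path from a vertex of $A$ to a vertex of $B$ is blocked by $C$. A distribution of $X_V\in\{0,1\}^V$ obeys the global Markov property for $\mathcal G$ if $X_A\perp\!\!\!\perp X_B\mid X_C$ for all disjoint $A,B,C$ with $A,B\ne\emptyset$ and $A$ m-separated from $B$ given $C$. Let $\mathcal P_{\mathcal G}\subseteq\mathbb R^{\{0,1\}^V}$ be the set of strictly positive probability distributions on $\{0,1\}^V$ that obey the global Markov property for $\mathcal G$. A *head* is a non-empty set $H\subseteq V$,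 no element of which is a proper ancestor of another, such that any two elements of $H$ are joined by a path of $\leftrightarrow$ edges within $\mathrm{an}(H)$; $\mathcal H(\mathcal G)$ is the set of heads. The *tail* of $H$ is $\mathrm{tail}(H)=(D\setminus H)\cup\mathrm{pa}(D)$ with $D=\mathrm{dis}_{\mathrm{an}(H)}(H)$. For distinct heads put $H\prec K$ if $H\subseteq\mathrm{an}(K)$. For $W\subseteq V$ let $\Phi(W)$ be the set of $\prec$-maximal elements among the heads contained in $W$, and define recursively $[\emptyset]=\emptyset$ and $[W]=\Phi(W)\cup[W\setminus\bigcup\Phi(W)]$. For a strictly positive vector $p\in\mathbb R^{\{0,1\}^V}$ let $q(p)$ be the vector of all $$q_H(i_T)=P(X_H=0\mid X_T=i_T)=\frac{\sum_{x:\,x_H=0,\,x_T=i_T}p_x}{\sum_{x:\,x_T=i_T}p_x},\qquad H\in\mathcal H(\mathcal G),\ T=\mathrm{tail}(H),\ i_T\in\{0,1\}^T,$$ let $\mathcal Q_{\mathcal G}=q(\mathcal P_{\mathcal G})$, and for a real vector $q$ with this index set let $p(q)\in\mathbb R^{\{0,1\}^V}$ be given by $$p_i(q)=\sum_{C:\,O_i\subseteq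 C\subseteq V}(-1)^{|C\setminus O_i|}\prod_{H\in[C]}q_H(i_{\mathrm{tail}(H)}),\qquad O_i=\{v\in V: i_v=0\}.$$ **Theorem.** Let $\mathcal G$ be an ADMG on a finite set $V$, and let $$d=\sum_{H\in\mathcal H(\mathcal G)}\bigl|\{0,1\}^{\mathrm{tail}(H)}\bigr|=\sum_{H\in\mathcal H(\mathcal G)}2^{|\mathrm{tail}(H)|}.$$ Then $\mathcal P_{\mathcal G}$ is smoothly parametrized by $q\in\mathcal Q_{\mathcal G}$, that is: 1. $\mathcal Q_{\mathcal G}$ is an open subset of $\mathbb R^d$. 2. The map $q\mapsto p(q)$ is a bijection from $\mathcal Q_{\mathcal G}$ onto $\mathcal P_{\mathcal G}$ with inverse $p\mapsto q(p)$. 3. The map $q\mapsto p(q)$ is multilinear, in the sense that each $p_i(q)$ is a polynomial in the coordinates of $q$ of degree at most one in every coordinate; in particular it is $C^\infty$. The inverse $p\mapsto q(p)$ is $C^\infty$ on the open set of all strictly positive vectors, which contains $\mathcal P_{\mathcal G}$. 4. The Jacobian $\partial p/\partial q$ at every point of $\mathcal Q_{\mathcal G}$ and the Jacobian $\partial q/\partial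 p$ at every point of $\mathcal P_{\mathcal G}$ have full rank $d$. Consequently, $\mathcal P_{\mathcal G}$ is a curved exponential family of dimension $d$: there is a regular exponential family of distributions $h(x)\exp(\langle\eta,T(x)\rangle-A(\eta))$, $\eta\in\mathbb R^k$, on $\{0,1\}^V$ with $h>0$ and with $1,T_1,\dots,T_k$ linearly independent, such that $\mathcal P_{\mathcal G}$ consists of the members of it whose natural parameters are of the form $\eta(\theta)$, $\theta\in\Theta$, for a non-empty open set $\Theta\subseteq\mathbb R^d$ and a $C^\infty$ map $\eta:\Theta\to\mathbb R^k$ that is a homeomorphism onto its image and has derivative of rank $d$ everywhere. -/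

import Mathlib

open scoped ContDiff

/-! ## Acyclic directed mixed graphs -/

/-- An acyclic directed mixed graph on the vertex set `V`: a directed acyclic graph `dir`
(`dir v w` is `v → w`) together with a set of unordered pairs of distinct vertices
(`bi.Adj v w` is `v ↔ w`).  Two vertices may be joined by both kinds of edge. -/
structure ADMG (V : Type*) where
  dir : V → V → Prop
  bi : SimpleGraph V
  acyclic : ∀ v, ¬ Relation.TransGen dir v v

namespace ADMG

section Separation

variable {V : Type*}

/-- An edge of the graph, traversed from the first vertex to the second one. -/
inductive Edge (G : ADMG V) : V → V → Type _
  | forward {v w : V} (h : G.dir v w) : Edge G v w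
  | backward {v w : V} (h : G.dir w v) : Edge G v w
  | bidirected {v w : V} (h : G.bi.Adj v w) : Edge G v w

/-- The edge has an arrowhead at the vertex where its traversal starts. -/
def Edge.HeadAtStart {G : ADMG V} {v w : V} : G.Edge v w → Prop
  | .forward _ => False
  | .backward _ => True
  | .bidirected _ => True

/-- The edge has an arrowhead at the vertex where its traversal ends. -/
def Edge.HeadAtEnd {G : ADMG V} {v w : V} : G.Edge v w → Prop
  | .forward _ => True
  | .backward _ => False
  | .bidirected _ => True

/-- Sequences of consecutive edges. -/
inductive Walk (G : ADMG V) : V → V → Type _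
  | nil (v : V) : Walk G v v
  | cons {u v w : V} (e : G.Edge u v) (p : Walk G v w) : Walk G u w

namespace Walk

variable {G : ADMG V}

/-- The sequence of vertices visited. -/
def support : {u w : V} → G.Walk u w → List V
  | _, _, .nil v => [v]
  | u, _, .cons _ p => u :: p.support

/-- A path is a walk without repetition of a vertex. -/
def IsPath {u w : V} (p : G.Walk u w) : Prop := p.support.Nodup

/-- `c` occurs as a non-endpoint of the walk at which both adjacent edges have an arrowhead. -/
def IsCollider : {u w : V} → G.Walk u w → V → Prop
  | _, _, .nil _, _ => False
  | _, _, .cons _ (.nil _), _ => False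
  | _, _, .cons (v := v) e (.cons f p), c =>
      (c = v ∧ e.HeadAtEnd ∧ f.HeadAtStart) ∨ IsCollider (.cons f p) c

/-- `c` occurs as a non-endpoint of the walk at which some adjacent edge has no arrowhead. -/
def IsNonCollider : {u w : V} → G.Walk u w → V → Prop
  | _, _, .nil _, _ => False
  | _, _, .cons _ (.nil _), _ => False
  | _, _, .cons (v := v) e (.cons f p), c =>
      (c = v ∧ ¬ (e.HeadAtEnd ∧ f.HeadAtStart)) ∨ IsNonCollider (.cons f p) c

end Walk

end Separation

variable {V : Type*} [Fintype V] [DecidableEq V] (G : ADMG V)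

/-! ### Familial terminology -/

open Classical in
/-- The ancestors of (elements of) `W`; every vertex is an ancestor of itself. -/
noncomputable def an (W : Finset V) : Finset V :=
  Finset.univ.filter fun w => ∃ v ∈ W, Relation.ReflTransGen G.dir w v

open Classical in
/-- The parents of elements of `W`. -/
noncomputable def pa (W : Finset V) : Finset V :=
  Finset.univ.filter fun w => ∃ v ∈ W, G.dir w v

open Classical in
/-- The vertices of `W` with no proper descendant in `W`. -/
noncomputable def barren (W : Finset V) : Finset V :=
  W.filter fun v => ∀ w ∈ W, Relation.ReflTransGen G.dir v w → w = v

open Classical in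
/-- The union of the districts of the elements of `W` (those lying in `A`) in the induced
subgraph on `A`. -/
noncomputable def dis (A W : Finset V) : Finset V :=
  A.filter fun w => ∃ v ∈ W, v ∈ A ∧
    Relation.ReflTransGen (fun a b => a ∈ A ∧ b ∈ A ∧ G.bi.Adj a b) v w

/-! ### m-separation and the global Markov property -/

/-- The path `p` is blocked by `C`: some non-collider on `p` is in `C`, or some collider on `p`
is not an ancestor of `C`. -/
def Blocked {v w : V} (p : G.Walk v w) (C : Finset V) : Prop :=
  (∃ c, p.IsNonCollider c ∧ c ∈ C) ∨ (∃ c, p.IsCollider c ∧ c ∉ G.an C)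

/-- `A` and `B` are m-separated given `C` (used for disjoint `A`, `B`, `C`). -/
def MSep (A B C : Finset V) : Prop :=
  ∀ a ∈ A, ∀ b ∈ B, ∀ p : G.Walk a b, p.IsPath → G.Blocked p C

end ADMG

/-! ## Binary distributions -/

section Binary

variable {V : Type*} [Fintype V] [DecidableEq V]

open Classical in
/-- The probability of the event `E` under the mass function `p`. -/
noncomputable def evPr {X : Type*} [Fintype X] (p : X → ℝ) (E : X → Prop) : ℝ :=
  ∑ x with E x, p x

/-- The conditional probability of `E` given `F`. -/
noncomputable def evCondPr {X : Type*} [Fintype X] (p : X → ℝ) (E F : X → Prop) : ℝ :=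
  evPr p (fun x => E x ∧ F x) / evPr p F

/-- `X_A` is independent of `X_B` conditionally on `X_C`:
`P(X_A = i_A, X_B = i_B | X_C = i_C) = P(X_A = i_A | X_C = i_C) P(X_B = i_B | X_C = i_C)`
for all values `i` (both sides are `0` when `P(X_C = i_C) = 0`). -/
def CondIndepVars (p : (V → Fin 2) → ℝ) (A B C : Finset V) : Prop :=
  ∀ i : V → Fin 2,
    evCondPr p (fun x => (∀ v ∈ A, x v = i v) ∧ ∀ v ∈ B, x v = i v) (fun x => ∀ v ∈ C, x v = i v) =
      evCondPr p (fun x => ∀ v ∈ A, x v = i v) (fun x => ∀ v ∈ C, x v = i v) *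
        evCondPr p (fun x => ∀ v ∈ B, x v = i v) (fun x => ∀ v ∈ C, x v = i v)

end Binary

namespace ADMG

variable {V : Type*} [Fintype V] [DecidableEq V] (G : ADMG V)

/-- The global Markov property. -/
def GlobalMarkov (p : (V → Fin 2) → ℝ) : Prop :=
  ∀ A B C : Finset V, Disjoint A B → Disjoint A C → Disjoint B C → A.Nonempty → B.Nonempty →
    G.MSep A B C → CondIndepVars p A B C

/-- The model of the graph: all strictly positive binary distributions that obey the global
Markov property. -/
def model : Set ((V → Fin 2) → ℝ) :=
  {p | (∀ x, 0 < p x) ∧ ∑ x, p x = 1 ∧ G.GlobalMarkov p}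

/-! ### Heads, tails and the partitioning function -/

/-- A head: a non-empty barren set contained in a single district of the induced subgraph on its
ancestors. -/
def IsHead (H : Finset V) : Prop :=
  H.Nonempty ∧ G.barren H = H ∧ ∀ v ∈ H, H ⊆ G.dis (G.an H) {v}

open Classical in
/-- The collection of all heads. -/
noncomputable def heads : Finset (Finset V) := Finset.univ.filter G.IsHead

/-- The tail of a head. -/
noncomputable def tail (H : Finset V) : Finset V :=
  (G.dis (G.an H) H \ H) ∪ G.pa (G.dis (G.an H) H)

/-- The (strict) partial ordering on heads. -/
def Prec (H K : Finset V) : Prop := H ≠ K ∧ H ⊆ G.an K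

open Classical in
/-- The maximal heads among those contained in `W`. -/
noncomputable def maxHeads (W : Finset V) : Finset (Finset V) :=
  G.heads.filter fun H => H ⊆ W ∧ ∀ K ∈ G.heads, K ⊆ W → ¬ G.Prec H K

/-- The elements of `W` in none of its maximal heads. -/
noncomputable def rest (W : Finset V) : Finset V := W \ (G.maxHeads W).biUnion id

set_option linter.unusedSectionVars false in
lemma mem_an {W : Finset V} {w : V} :
    w ∈ G.an W ↔ ∃ v ∈ W, Relation.ReflTransGen G.dir w v := by
  simp [an]

lemma singleton_mem_heads (v : V) : {v} ∈ G.heads := by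
  simp only [heads, Finset.mem_filter, Finset.mem_univ, true_and, IsHead]
  refine ⟨Finset.singleton_nonempty v, ?_, ?_⟩
  · ext w
    simp only [barren, Finset.mem_filter, Finset.mem_singleton]
    constructor
    · exact fun h => h.1
    · rintro rfl
      exact ⟨rfl, fun w h _ => h⟩
  · intro w hw u hu
    rw [Finset.mem_singleton] at hw hu
    subst hw hu
    have hu : u ∈ G.an {u} := G.mem_an.2 ⟨u, by simp, Relation.ReflTransGen.refl⟩
    simp only [dis, Finset.mem_filter]
    exact ⟨hu, u, by simp, hu, Relation.ReflTransGen.refl⟩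

lemma an_card_lt_of_prec {H K : Finset V} (hH : H ∈ G.heads) (hK : K ∈ G.heads)
    (h : G.Prec H K) : (G.an H).card < (G.an K).card := by
  have key : ∀ {H K : Finset V}, H ∈ G.heads → H ⊆ G.an K → K ⊆ G.an H → H ⊆ K := by
    intro H K hH h1 h2 v hv
    obtain ⟨w, hw, hvw⟩ := G.mem_an.1 (h1 hv)
    obtain ⟨u, hu, hwu⟩ := G.mem_an.1 (h2 hw)
    have hb : v ∈ G.barren H := by
      simp only [heads, Finset.mem_filter, IsHead] at hH
      rw [hH.2.2.1]; exact hv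
    simp only [barren, Finset.mem_filter] at hb
    have huv := hb.2 u hu (hvw.trans hwu)
    subst huv
    rcases Relation.reflTransGen_iff_eq_or_transGen.1 hvw with h | h
    · exact h ▸ hw
    · exact absurd (h.trans_left hwu) (G.acyclic _)
  have hsub : G.an H ⊆ G.an K := by
    intro w hw
    obtain ⟨v, hv, hwv⟩ := G.mem_an.1 hw
    obtain ⟨u, hu, hvu⟩ := G.mem_an.1 (h.2 hv)
    exact G.mem_an.2 ⟨u, hu, hwv.trans hvu⟩
  refine Finset.card_lt_card (Finset.ssubset_iff_subset_ne.2 ⟨hsub, fun heq => ?_⟩)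
  have hK' : K ⊆ G.an H := fun v hv =>
    heq ▸ G.mem_an.2 ⟨v, hv, Relation.ReflTransGen.refl⟩
  exact h.1 (Finset.Subset.antisymm (key hH h.2 hK') (key hK hK' h.2))

lemma rest_ssubset {W : Finset V} (hW : W ≠ ∅) : G.rest W ⊂ W := by
  classical
  obtain ⟨v, hv⟩ := Finset.nonempty_iff_ne_empty.2 hW
  obtain ⟨H, hH, hmax⟩ := Finset.exists_max_image (G.heads.filter (· ⊆ W))
    (fun H => (G.an H).card)
    ⟨{v}, Finset.mem_filter.2 ⟨G.singleton_mem_heads v, Finset.singleton_subset_iff.2 hv⟩⟩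
  rw [Finset.mem_filter] at hH
  have hmem : H ∈ G.maxHeads W := by
    simp only [maxHeads, Finset.mem_filter]
    refine ⟨hH.1, hH.2, fun K hK hKW hp => ?_⟩
    exact absurd (hmax K (Finset.mem_filter.2 ⟨hK, hKW⟩))
      (not_le.2 (G.an_card_lt_of_prec hH.1 hK hp))
  have hne : H.Nonempty := by
    have := hH.1
    simp only [heads, Finset.mem_filter, IsHead] at this
    exact this.2.1
  obtain ⟨u, hu⟩ := hne
  refine Finset.ssubset_iff_subset_ne.2 ⟨Finset.sdiff_subset, fun heq => ?_⟩
  have hur : u ∈ G.rest W := by rw [heq]; exact hH.2 hu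
  exact (Finset.mem_sdiff.1 hur).2 (Finset.mem_biUnion.2 ⟨H, hmem, hu⟩)

/-- The partitioning function `[W]`: remove the maximal heads of `W` and apply the procedure
again to what remains. -/
noncomputable def partition (W : Finset V) : Finset (Finset V) :=
  if _h : W = ∅ then ∅ else G.maxHeads W ∪ partition (G.rest W)
termination_by W.card
decreasing_by exact Finset.card_lt_card (G.rest_ssubset _h)

/-! ### The parametrization -/

/-- The index set of the parameter vector: pairs of a head and a value of its tail. -/
abbrev ParamIndex : Type _ := Σ H : G.heads, (G.tail H.1 → Fin 2)

/-- The vector of conditional probabilities `q_H(i_T) = P(X_H = 0 | X_T = i_T)` of `p`. -/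
noncomputable def qMap (p : (V → Fin 2) → ℝ) : G.ParamIndex → ℝ := fun k =>
  evCondPr p (fun x => ∀ v ∈ k.1.1, x v = 0) (fun x => ∀ v : G.tail k.1.1, x v = k.2 v)

/-- The set of valid parameter values. -/
def validParams : Set (G.ParamIndex → ℝ) := G.qMap '' G.model

/-- The vertices to which `i` assigns the value `0`. -/
def zeros (i : V → Fin 2) : Finset V := Finset.univ.filter fun v => i v = 0

/-- The map `q ↦ p(q)`, with
`p_i(q) = ∑_{O ⊆ C ⊆ V} (-1)^{|C \ O|} ∏_{H ∈ [C]} q_H(i_T)` for `O = i⁻¹(0)`. -/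
noncomputable def pMap (q : G.ParamIndex → ℝ) : (V → Fin 2) → ℝ := fun i =>
  ∑ C : Finset V with zeros i ⊆ C, (-1 : ℝ) ^ (C \ zeros i).card *
    ∏ H : G.heads with H.1 ∈ G.partition C, q ⟨H, fun v => i v⟩

end ADMG

/-! ## Jacobians and curved exponential families -/

/-- The Jacobian matrix of `f` at `x`. -/
noncomputable def jacobian {ι κ : Type*} [Fintype ι] [DecidableEq ι] [Fintype κ]
    (f : (ι → ℝ) → (κ → ℝ)) (x : ι → ℝ) : Matrix κ ι ℝ :=
  LinearMap.toMatrix' (fderiv ℝ f x).toLinearMap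

/-- The mass function with natural parameter `η` in the exponential family on the finite set `X`
with base measure `h` and sufficient statistic `T`. -/
noncomputable def expFamily {X : Type*} [Fintype X] {k : ℕ} (h : X → ℝ) (T : X → Fin k → ℝ)
    (η : Fin k → ℝ) : X → ℝ := fun x =>
  h x * Real.exp (∑ j, η j * T x j) / ∑ y, h y * Real.exp (∑ j, η j * T y j)

/-- A set `P` of strictly positive distributions on the finite set `X` is a curved exponential
family of dimension `d`: inside some regular exponential family of order `k` (with a minimal
sufficient statistic; its natural parameter space is all of `ℝ^k` as `X` is finite), `P` is the
subfamily whose natural parameters are the image of a non-empty open subset of `ℝ^d` under a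
smooth embedding (injective, homeomorphic onto its image, with derivative of full rank). -/
def IsCurvedExponentialFamily {X : Type*} [Fintype X] (P : Set (X → ℝ)) (d : ℕ) : Prop :=
  ∃ (k : ℕ) (h : X → ℝ) (T : X → Fin k → ℝ),
    (∀ x, 0 < h x) ∧
    (∀ (c₀ : ℝ) (c : Fin k → ℝ), (∀ x, c₀ + ∑ j, c j * T x j = 0) → c = 0) ∧
    ∃ (Θ : Set (Fin d → ℝ)) (η : (Fin d → ℝ) → (Fin k → ℝ)),
      IsOpen Θ ∧ Θ.Nonempty ∧
      ContDiffOn ℝ ∞ η Θ ∧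
      Topology.IsEmbedding (fun θ : Θ => η θ) ∧
      (∀ θ ∈ Θ, (jacobian η θ).rank = d) ∧
      P = (fun θ => expFamily h T (η θ)) '' Θ

/-! The valid parameters turn out to be exactly the q for which every p_i(q) is positive
(`validParams_eq`). Openness is then continuity of a polynomial map, and as the two maps are smooth
and mutually inverse, the chain rule gives both Jacobians full rank. What must be shown is that a
positive p(q) lies in the model and returns q, and that every p in the model equals p(q(p)).

Both halves use `subsetMap q S`, the analogue of p(q) on a vertex set S. For ancestral S, summing
out a childless vertex removes it from S (`subsetMap_update`), so `subsetMap q S` is the S-marginal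
of p(q). It also factorizes along unions of districts of S (`subsetMap_mul`), each factor depending
only on its vertices and their parents. Finally, where x vanishes on a head H, the parameter of H
splits off from the function for an(H) and leaves the one for an(H) \ H (`subsetMap_an`). The last
two facts reflect that [C] splits along districts and that maximal heads may be removed one at a
time.

A positive p(q) is Markov because an m-separation given C yields a union D of districts of the
ancestral set such that the parents of D, and those of its complement, stay on their side up to C
(`MSep.exists_isBiClosed`); the factorization along D then gives the independence. The splitting at
heads gives q(p(q)) = q.

Conversely, induction over ancestral S shows that the S-marginal of p in the model is `subsetMap` at
q(p) (`marg_eq_subsetMap`). If the barren vertices of S form a head H, independence of H from the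
remaining vertices of S given its tail determines the probabilities with x_H = 0, and the others
follow by subtraction from smaller ancestral marginals. Otherwise the barren vertices are spread
over several districts, and an independence between them matches the factorization.

The ambient exponential family is the saturated one, with log odds as natural parameters. -/

namespace ADMG

/-! ### Combinatorics of ancestral sets, districts, heads and the partitioning function. -/

section Graph

set_option linter.unusedSectionVars false

variable {V : Type*} [Fintype V] [DecidableEq V] {G : ADMG V}

/-! ### Ancestral sets -/

/-- A set of vertices that contains all its ancestors. -/
def IsAncestral (G : ADMG V) (S : Finset V) : Prop := ∀ ⦃v w⦄, G.dir v w → w ∈ S → v ∈ S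

lemma IsAncestral.mem_of_reflTransGen {S : Finset V} (hS : G.IsAncestral S) {v w : V}
    (h : Relation.ReflTransGen G.dir v w) (hw : w ∈ S) : v ∈ S := by
  induction h using Relation.ReflTransGen.head_induction_on with
  | refl => exact hw
  | head h _ ih => exact hS h ih

lemma isAncestral_an (W : Finset V) : G.IsAncestral (G.an W) := by
  intro v w h hw
  obtain ⟨u, hu, hwu⟩ := G.mem_an.1 hw
  exact G.mem_an.2 ⟨u, hu, hwu.head h⟩

lemma isAncestral_univ : G.IsAncestral Finset.univ := fun _ _ _ _ => Finset.mem_univ _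

lemma IsAncestral.an_subset {S W : Finset V} (hS : G.IsAncestral S) (hW : W ⊆ S) :
    G.an W ⊆ S := by
  intro v hv
  obtain ⟨u, hu, hvu⟩ := G.mem_an.1 hv
  exact hS.mem_of_reflTransGen hvu (hW hu)

lemma subset_an (W : Finset V) : W ⊆ G.an W :=
  fun v hv => G.mem_an.2 ⟨v, hv, Relation.ReflTransGen.refl⟩

lemma an_mono {W W' : Finset V} (h : W ⊆ W') : G.an W ⊆ G.an W' :=
  (isAncestral_an W').an_subset (h.trans (subset_an W'))

/-- Removing vertices without children from an ancestral set leaves an ancestral set. -/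
lemma IsAncestral.sdiff {S K : Finset V} (hS : G.IsAncestral S)
    (hK : ∀ k ∈ K, ∀ w ∈ S, ¬ G.dir k w) : G.IsAncestral (S \ K) := by
  intro v w h hw
  rw [Finset.mem_sdiff] at hw ⊢
  exact ⟨hS h hw.1, fun hv => hK v hv w hw.1 h⟩

lemma mem_pa {W : Finset V} {w : V} : w ∈ G.pa W ↔ ∃ v ∈ W, G.dir w v := by simp [pa]

lemma IsAncestral.pa_subset {S W : Finset V} (hS : G.IsAncestral S) (hW : W ⊆ S) :
    G.pa W ⊆ S := by
  intro v hv
  obtain ⟨w, hw, h⟩ := mem_pa.1 hv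
  exact hS h (hW hw)

/-! ### Barren sets -/

lemma mem_barren {W : Finset V} {v : V} :
    v ∈ G.barren W ↔ v ∈ W ∧ ∀ w ∈ W, Relation.ReflTransGen G.dir v w → w = v := by
  simp [barren]

lemma barren_subset (W : Finset V) : G.barren W ⊆ W := fun _ h => (mem_barren.1 h).1

lemma not_dir_of_mem_barren {W : Finset V} {v w : V} (hv : v ∈ G.barren W) (hw : w ∈ W) :
    ¬ G.dir v w := by
  intro h
  have := (mem_barren.1 hv).2 w hw (Relation.ReflTransGen.single h)
  subst this
  exact G.acyclic w (Relation.TransGen.single h)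

lemma barren_barren (W : Finset V) : G.barren (G.barren W) = G.barren W := by
  refine Finset.Subset.antisymm (barren_subset _) fun v hv => ?_
  exact mem_barren.2 ⟨hv, fun w hw h => (mem_barren.1 hv).2 w (barren_subset _ hw) h⟩

/-- By acyclicity and finiteness, passing to proper descendants inside `W` must stop, and it stops
at a barren vertex. -/
lemma exists_mem_barren {W : Finset V} {v : V} (hv : v ∈ W) :
    ∃ b ∈ G.barren W, Relation.ReflTransGen G.dir v b := by
  have hwf : WellFounded (fun a b => Relation.TransGen G.dir b a) := by
    have : IsTrans V (fun a b => Relation.TransGen G.dir b a) := ⟨fun _ _ _ h h' => h'.trans h⟩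
    have : Std.Irrefl (fun a b => Relation.TransGen G.dir b a) := ⟨G.acyclic⟩
    exact Finite.wellFounded_of_trans_of_irrefl _
  induction v using hwf.induction with
  | _ v ih =>
    by_cases hb : v ∈ G.barren W
    · exact ⟨v, hb, Relation.ReflTransGen.refl⟩
    · rw [mem_barren] at hb
      push Not at hb
      obtain ⟨w, hw, hvw, hne⟩ := hb hv
      rcases Relation.reflTransGen_iff_eq_or_transGen.1 hvw with h | h
      · exact absurd h hne
      · obtain ⟨b, hb, hwb⟩ := ih w h hw
        exact ⟨b, hb, hvw.trans hwb⟩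

lemma subset_an_barren (W : Finset V) : W ⊆ G.an (G.barren W) := by
  intro v hv
  obtain ⟨b, hb, h⟩ := exists_mem_barren (G := G) hv
  exact G.mem_an.2 ⟨b, hb, h⟩

lemma an_barren (W : Finset V) : G.an (G.barren W) = G.an W :=
  Finset.Subset.antisymm (an_mono (barren_subset W))
    ((isAncestral_an _).an_subset (subset_an_barren W))

lemma IsAncestral.an_eq {S : Finset V} (hS : G.IsAncestral S) : G.an S = S :=
  Finset.Subset.antisymm (hS.an_subset Finset.Subset.rfl) (subset_an S)

/-! ### Bidirected connection -/

/-- `v` and `w` are joined by bidirected edges inside `A`. -/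
def BiConn (G : ADMG V) (A : Finset V) : V → V → Prop :=
  Relation.ReflTransGen fun a b => a ∈ A ∧ b ∈ A ∧ G.bi.Adj a b

lemma BiConn.mono {A A' : Finset V} (h : A ⊆ A') {v w : V} (hc : G.BiConn A v w) :
    G.BiConn A' v w := by
  induction hc with
  | refl => exact Relation.ReflTransGen.refl
  | tail _ hab ih => exact ih.tail ⟨h hab.1, h hab.2.1, hab.2.2⟩

lemma BiConn.symm {A : Finset V} {v w : V} (hc : G.BiConn A v w) : G.BiConn A w v := by
  induction hc with
  | refl => exact Relation.ReflTransGen.refl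
  | tail _ hab ih => exact ih.head ⟨hab.2.1, hab.1, hab.2.2.symm⟩

lemma mem_dis {A W : Finset V} {w : V} :
    w ∈ G.dis A W ↔ w ∈ A ∧ ∃ v ∈ W, v ∈ A ∧ G.BiConn A v w := by
  simp [dis, BiConn]

/-- `D` is a union of districts of the induced subgraph on `S`. -/
def IsBiClosed (G : ADMG V) (S D : Finset V) : Prop :=
  D ⊆ S ∧ ∀ v ∈ D, ∀ w ∈ S, G.bi.Adj v w → w ∈ D

lemma isBiClosed_dis (S W : Finset V) : G.IsBiClosed S (G.dis S W) := by
  refine ⟨fun v hv => (mem_dis.1 hv).1, fun v hv w hw h => ?_⟩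
  obtain ⟨hvS, u, hu, huS, hc⟩ := mem_dis.1 hv
  exact mem_dis.2 ⟨hw, u, hu, huS, hc.tail ⟨hvS, hw, h⟩⟩

lemma IsBiClosed.compl {S D : Finset V} (h : G.IsBiClosed S D) : G.IsBiClosed S (S \ D) := by
  refine ⟨Finset.sdiff_subset, fun v hv w hw hvw => ?_⟩
  rw [Finset.mem_sdiff] at hv ⊢
  exact ⟨hw, fun hD => hv.2 (h.2 w hD v hv.1 hvw.symm)⟩

lemma IsBiClosed.mem_of_biConn {S D A : Finset V} (h : G.IsBiClosed S D) (hA : A ⊆ S) {v w : V}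
    (hv : v ∈ D) (hc : G.BiConn A v w) : w ∈ D := by
  induction hc with
  | refl => exact hv
  | tail _ hab ih => exact h.2 _ ih _ (hA hab.2.1) hab.2.2

lemma IsBiClosed.dis_subset {S D A W : Finset V} (h : G.IsBiClosed S D) (hA : A ⊆ S)
    (hW : W ⊆ D) : G.dis A W ⊆ D := by
  intro w hw
  obtain ⟨-, v, hv, -, hc⟩ := mem_dis.1 hw
  exact h.mem_of_biConn hA (hW hv) hc

/-! ### Heads and tails -/

lemma mem_heads {H : Finset V} : H ∈ G.heads ↔ G.IsHead H := by simp [heads]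

lemma IsHead.biConn {H : Finset V} (hH : G.IsHead H) {v w : V} (hv : v ∈ H) (hw : w ∈ H) :
    G.BiConn (G.an H) v w := by
  obtain ⟨-, u, hu, -, hc⟩ := mem_dis.1 (hH.2.2 v hv hw)
  rw [Finset.mem_singleton] at hu
  exact hu ▸ hc

lemma IsHead.not_dir {H : Finset V} (hH : G.IsHead H) {v w : V} (hv : v ∈ H)
    (hw : w ∈ G.an H) : ¬ G.dir v w := by
  intro h
  obtain ⟨u, hu, hwu⟩ := G.mem_an.1 hw
  rw [← hH.2.1] at hv
  have := (mem_barren.1 hv).2 u hu (hwu.head h)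
  subst this
  exact G.acyclic u (Relation.TransGen.head' h hwu)

lemma IsHead.subset_dis {H : Finset V} : H ⊆ G.dis (G.an H) H := fun v hv =>
  mem_dis.2 ⟨subset_an H hv, v, hv, subset_an H hv, Relation.ReflTransGen.refl⟩

/-- A head is connected by bidirected edges inside an(H), which lies in the ancestral set `S`, so it
cannot straddle districts of `S`. -/
lemma IsHead.subset_or_disjoint {S D H : Finset V} (hS : G.IsAncestral S)
    (hD : G.IsBiClosed S D) (hH : G.IsHead H) (hHS : H ⊆ S) : H ⊆ D ∨ H ⊆ S \ D := by
  by_cases h : ∃ v ∈ H, v ∈ D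
  · obtain ⟨v, hv, hvD⟩ := h
    exact Or.inl fun w hw => hD.mem_of_biConn (hS.an_subset hHS) hvD (hH.biConn hv hw)
  · push Not at h
    exact Or.inr fun w hw => Finset.mem_sdiff.2 ⟨hHS hw, h w hw⟩

lemma tail_subset_an (H : Finset V) : G.tail H ⊆ G.an H := by
  have hd : G.dis (G.an H) H ⊆ G.an H := (isBiClosed_dis _ _).1
  exact Finset.union_subset (Finset.sdiff_subset.trans hd) ((isAncestral_an H).pa_subset hd)

lemma tail_subset {S D H : Finset V} (hS : G.IsAncestral S) (hD : G.IsBiClosed S D)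
    (hHD : H ⊆ D) : G.tail H ⊆ D ∪ G.pa D := by
  have hd : G.dis (G.an H) H ⊆ D := hD.dis_subset (hS.an_subset (hHD.trans hD.1)) hHD
  refine Finset.union_subset_union (Finset.sdiff_subset.trans hd) fun v hv => ?_
  obtain ⟨w, hw, h⟩ := mem_pa.1 hv
  exact mem_pa.2 ⟨w, hd hw, h⟩

lemma IsHead.disjoint_tail {H : Finset V} (hH : G.IsHead H) {v : V} (hv : v ∈ G.tail H) :
    v ∉ H := by
  intro hvH
  rcases Finset.mem_union.1 hv with h | h
  · exact (Finset.mem_sdiff.1 h).2 hvH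
  · obtain ⟨w, hw, hvw⟩ := mem_pa.1 h
    exact hH.not_dir hvH ((isBiClosed_dis _ _).1 hw) hvw

/-- A tail vertex is either a parent of a vertex of an(H) or a proper ancestor of `H`; both give it
a child in `S`. Hence the parameters of heads in `S` ignore the coordinates of childless vertices.
-/
lemma not_mem_tail {S H : Finset V} {v : V} (hS : G.IsAncestral S) (hHS : H ⊆ S)
    (hv : ∀ w ∈ S, ¬ G.dir v w) : v ∉ G.tail H := by
  intro h
  have hAS := hS.an_subset hHS
  rcases Finset.mem_union.1 h with h | h
  · obtain ⟨hd, hvH⟩ := Finset.mem_sdiff.1 h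
    obtain ⟨u, hu, hvu⟩ := G.mem_an.1 ((isBiClosed_dis _ _).1 hd)
    rcases Relation.ReflTransGen.cases_head hvu with rfl | ⟨c, hvc, hcu⟩
    · exact hvH hu
    · exact hv c (hAS (G.mem_an.2 ⟨u, hu, hcu⟩)) hvc
  · obtain ⟨w, hw, hvw⟩ := mem_pa.1 h
    exact hv w (hAS ((isBiClosed_dis _ _).1 hw)) hvw

/-! ### The partitioning function -/

lemma mem_maxHeads {W H : Finset V} :
    H ∈ G.maxHeads W ↔ G.IsHead H ∧ H ⊆ W ∧ ∀ K, G.IsHead K → K ⊆ W → ¬ G.Prec H K := by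
  simp [maxHeads, mem_heads]

lemma mem_maxHeads_of_subset {W W' H : Finset V} (hH : H ∈ G.maxHeads W) (hW : W' ⊆ W)
    (hHW : H ⊆ W') : H ∈ G.maxHeads W' := by
  rw [mem_maxHeads] at hH ⊢
  exact ⟨hH.1, hHW, fun K hK hKW => hH.2.2 K hK (hKW.trans hW)⟩

/-- A head strictly above `H` would have strictly more ancestors, but all ancestors of `C` are
already in an(H). -/
lemma IsHead.mem_maxHeads {H C : Finset V} (hH : G.IsHead H) (hHC : H ⊆ C)
    (hC : C ⊆ G.an H) : H ∈ G.maxHeads C := by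
  refine ADMG.mem_maxHeads.2 ⟨hH, hHC, fun K hK hKC hp => ?_⟩
  have h1 := G.an_card_lt_of_prec (mem_heads.2 hH) (mem_heads.2 hK) hp
  have h2 := Finset.card_le_card ((isAncestral_an H).an_subset (hKC.trans hC))
  omega

lemma isHead_barren_union {M N : Finset V} (hM : G.IsHead M) (hN : G.IsHead N) {v : V}
    (hvM : v ∈ M) (hvN : v ∈ N) : G.IsHead (G.barren (M ∪ N)) := by
  have hconn : ∀ w ∈ M ∪ N, G.BiConn (G.an (M ∪ N)) v w := by
    intro w hw
    rcases Finset.mem_union.1 hw with h | h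
    · exact (hM.biConn hvM h).mono (an_mono Finset.subset_union_left)
    · exact (hN.biConn hvN h).mono (an_mono Finset.subset_union_right)
  refine ⟨?_, barren_barren _, fun u hu w hw => ?_⟩
  · obtain ⟨b, hb, -⟩ := exists_mem_barren (G := G) (Finset.mem_union_left N hvM)
    exact ⟨b, hb⟩
  · rw [mem_dis]
    refine ⟨subset_an _ hw, u, Finset.mem_singleton_self u, subset_an _ hu, ?_⟩
    rw [an_barren]
    exact (hconn u (barren_subset _ hu)).symm.trans (hconn w (barren_subset _ hw))

/-- The common vertex connects `M` and `N`, so the barren part of their union is again a head in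
`W`. It dominates both, and maximality forces both to equal it. -/
lemma eq_of_mem_maxHeads {W M N : Finset V} (hM : M ∈ G.maxHeads W) (hN : N ∈ G.maxHeads W)
    {v : V} (hvM : v ∈ M) (hvN : v ∈ N) : M = N := by
  rw [mem_maxHeads] at hM hN
  have hK := isHead_barren_union hM.1 hN.1 hvM hvN
  have hKW : G.barren (M ∪ N) ⊆ W :=
    (barren_subset _).trans (Finset.union_subset hM.2.1 hN.2.1)
  have h : ∀ L, L ⊆ M ∪ N → (∀ K, G.IsHead K → K ⊆ W → ¬ G.Prec L K) →
      L = G.barren (M ∪ N) := by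
    intro L hL hmax
    by_contra hne
    exact hmax _ hK hKW ⟨hne, hL.trans (subset_an_barren _)⟩
  rw [h M Finset.subset_union_left hM.2.2, ← h N Finset.subset_union_right hN.2.2]

lemma partition_empty : G.partition ∅ = ∅ := by
  rw [partition, dif_pos rfl]

lemma partition_of_ne {W : Finset V} (hW : W ≠ ∅) :
    G.partition W = G.maxHeads W ∪ G.partition (G.rest W) := by
  rw [partition, dif_neg hW]

lemma partition_spec (W : Finset V) : ∀ H ∈ G.partition W, G.IsHead H ∧ H ⊆ W := by
  induction W using Finset.strongInduction with
  | _ W ih =>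
    by_cases hW : W = ∅
    · subst hW
      simp [partition_empty]
    · rw [partition_of_ne hW]
      intro H hH
      rcases Finset.mem_union.1 hH with h | h
      · exact ⟨(mem_maxHeads.1 h).1, (mem_maxHeads.1 h).2.1⟩
      · have := ih _ (G.rest_ssubset hW) H h
        exact ⟨this.1, this.2.trans (G.rest_ssubset hW).1⟩

lemma disjoint_partition {W W' : Finset V} (h : Disjoint W W') :
    Disjoint (G.partition W) (G.partition W') := by
  rw [Finset.disjoint_left]
  intro H hH hH'
  obtain ⟨⟨⟨v, hv⟩, -⟩, hHW⟩ := partition_spec W H hH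
  exact Finset.disjoint_left.1 h (hHW hv) ((partition_spec W' H hH').2 hv)

/-- Maximal heads may be removed in any order. -/
lemma partition_eq_union (W : Finset V) : ∀ N ⊆ G.maxHeads W,
    G.partition W = N ∪ G.partition (W \ N.biUnion id) := by
  induction W using Finset.strongInduction with
  | _ W ih =>
    intro N hN
    rcases N.eq_empty_or_nonempty with rfl | ⟨M, hM⟩
    · simp
    have hMW := (mem_maxHeads.1 (hN hM)).2.1
    obtain ⟨v, hv⟩ := (mem_maxHeads.1 (hN hM)).1.1
    have hW : W ≠ ∅ := Finset.ne_empty_of_mem (hMW hv)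
    have hlt : W \ N.biUnion id ⊂ W := by
      refine Finset.ssubset_iff_subset_ne.2 ⟨Finset.sdiff_subset, fun heq => ?_⟩
      have : v ∈ W \ N.biUnion id := heq.symm ▸ hMW hv
      exact (Finset.mem_sdiff.1 this).2 (Finset.mem_biUnion.2 ⟨M, hM, hv⟩)
    -- Distinct maximal heads are disjoint, so those not in `N` survive the removal of `N` and stay
    -- maximal. Removing them as well leaves `G.rest W`.
    have hN' : G.maxHeads W \ N ⊆ G.maxHeads (W \ N.biUnion id) := by
      intro K hK
      rw [Finset.mem_sdiff] at hK
      refine mem_maxHeads_of_subset hK.1 Finset.sdiff_subset fun u hu => ?_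
      refine Finset.mem_sdiff.2 ⟨(mem_maxHeads.1 hK.1).2.1 hu, fun hu' => ?_⟩
      obtain ⟨L, hL, huL⟩ := Finset.mem_biUnion.1 hu'
      exact hK.2 (eq_of_mem_maxHeads hK.1 (hN hL) hu huL ▸ hL)
    have hrest : (W \ N.biUnion id) \ (G.maxHeads W \ N).biUnion id = G.rest W := by
      rw [sdiff_sdiff_left, Finset.sup_eq_union, ← Finset.union_biUnion,
        Finset.union_sdiff_of_subset hN, rest]
    rw [ih _ hlt _ hN', hrest, ← Finset.union_assoc, Finset.union_sdiff_of_subset hN,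
      partition_of_ne hW]

lemma partition_eq_insert {W M : Finset V} (hM : M ∈ G.maxHeads W) :
    G.partition W = insert M (G.partition (W \ M)) := by
  rw [partition_eq_union W {M} (Finset.singleton_subset_iff.2 hM)]
  rw [Finset.singleton_biUnion, id, Finset.insert_eq]

lemma exists_mem_maxHeads {W : Finset V} (hW : W ≠ ∅) : ∃ M, M ∈ G.maxHeads W := by
  by_contra h
  push Not at h
  have h0 := G.rest_ssubset hW
  rw [rest, Finset.eq_empty_of_forall_notMem h] at h0
  simp at h0

/-- The partition of a set splits along the districts of an ancestral superset. -/
lemma partition_union {S D : Finset V} (hS : G.IsAncestral S) (hD : G.IsBiClosed S D)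
    (C : Finset V) (hC : C ⊆ S) :
    G.partition C = G.partition (C ∩ D) ∪ G.partition (C \ D) := by
  induction C using Finset.strongInduction with
  | _ C ih =>
    by_cases hC0 : C = ∅
    · subst hC0
      simp [partition_empty]
    obtain ⟨M, hM⟩ := exists_mem_maxHeads (G := G) hC0
    obtain ⟨hMh, hMC, -⟩ := mem_maxHeads.1 hM
    have hlt : C \ M ⊂ C := by
      obtain ⟨v, hv⟩ := hMh.1
      refine Finset.ssubset_iff_subset_ne.2 ⟨Finset.sdiff_subset, fun heq => ?_⟩
      have : v ∈ C \ M := heq.symm ▸ hMC hv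
      exact (Finset.mem_sdiff.1 this).2 hv
    rw [partition_eq_insert hM, ih _ hlt (Finset.sdiff_subset.trans hC)]
    -- The maximal head `M` lies entirely in `D` or outside it. It remains maximal in that part of
    -- `C`, and the other part is untouched by removing it.
    rcases hMh.subset_or_disjoint hS hD (hMC.trans hC) with h | h
    · have h1 : (C \ M) \ D = C \ D := by
        ext u
        have := @h u
        simp only [Finset.mem_sdiff]
        tauto
      have h2 : (C \ M) ∩ D = (C ∩ D) \ M := by
        ext u
        simp only [Finset.mem_sdiff, Finset.mem_inter]
        tauto
      rw [h1, h2, partition_eq_insert (mem_maxHeads_of_subset hM Finset.inter_subset_left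
        (Finset.subset_inter hMC h)), Finset.insert_union]
    · have hMD : M ⊆ C \ D := fun u hu =>
        Finset.mem_sdiff.2 ⟨hMC hu, (Finset.mem_sdiff.1 (h hu)).2⟩
      have h1 : (C \ M) ∩ D = C ∩ D := by
        ext u
        have := @hMD u
        simp only [Finset.mem_sdiff, Finset.mem_inter] at this ⊢
        tauto
      have h2 : (C \ M) \ D = (C \ D) \ M := by
        ext u
        simp only [Finset.mem_sdiff]
        tauto
      rw [h1, h2, partition_eq_insert (mem_maxHeads_of_subset hM Finset.sdiff_subset hMD),
        Finset.union_insert]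

end Graph

end ADMG

namespace ADMG

/-! ### m-separation expressed through unions of districts. -/

section Paths

set_option linter.unusedSectionVars false

variable {V : Type*} [Fintype V] [DecidableEq V] {G : ADMG V}

/-! ### Unblocked walks -/

/-- The first vertex of the walk does not block it given `C`, when the walk is entered by an edge
that has an arrowhead there if and only if `h` holds. -/
def Walk.Junction (C : Finset V) (h : Prop) : {u w : V} → G.Walk u w → Prop
  | _, _, .nil _ => True
  | u, _, .cons f _ =>
      (h ∧ f.HeadAtStart → u ∈ G.an C) ∧ (¬ (h ∧ f.HeadAtStart) → u ∉ C)

/-- No interior occurrence of a vertex blocks the walk given `C`. -/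
def Walk.Unblocked (C : Finset V) : {u w : V} → G.Walk u w → Prop
  | _, _, .nil _ => True
  | _, _, .cons e p => p.Junction C e.HeadAtEnd ∧ p.Unblocked C

lemma Walk.not_blocked_iff (C : Finset V) {u w : V} (p : G.Walk u w) :
    ¬ G.Blocked p C ↔ p.Unblocked C := by
  induction p with
  | nil v => simp [Blocked, Walk.IsNonCollider, Walk.IsCollider, Walk.Unblocked]
  | @cons u v w e p ih =>
    cases p with
    | nil => simp [Blocked, Walk.IsNonCollider, Walk.IsCollider, Walk.Unblocked, Walk.Junction]
    | cons f p =>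
      rw [Walk.Unblocked, ← ih]
      have hN : ∀ c, (Walk.cons e (.cons f p)).IsNonCollider c ↔
          (c = v ∧ ¬ (e.HeadAtEnd ∧ f.HeadAtStart)) ∨ (Walk.cons f p).IsNonCollider c :=
        fun c => by rw [Walk.IsNonCollider]
      have hC : ∀ c, (Walk.cons e (.cons f p)).IsCollider c ↔
          (c = v ∧ e.HeadAtEnd ∧ f.HeadAtStart) ∨ (Walk.cons f p).IsCollider c :=
        fun c => by rw [Walk.IsCollider]
      simp only [Blocked, hN, hC, Walk.Junction]
      generalize (e.HeadAtEnd ∧ f.HeadAtStart) = a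
      push Not
      constructor
      · rintro ⟨h1, h2⟩
        exact ⟨⟨fun h => h2 v (Or.inl ⟨rfl, h⟩), fun h => h1 v (Or.inl ⟨rfl, h⟩)⟩,
          fun c hc => h1 c (Or.inr hc), fun c hc => h2 c (Or.inr hc)⟩
      · rintro ⟨⟨h1, h2⟩, h3, h4⟩
        constructor
        · rintro c (⟨rfl, h⟩ | h)
          · exact h2 h
          · exact h3 c h
        · rintro c (⟨rfl, h⟩ | h)
          · exact h1 h
          · exact h4 c h

/-- An edge without an arrowhead at its start is a directed edge. -/
lemma Edge.of_not_headAtStart {u v : V} {e : G.Edge u v} (h : ¬ e.HeadAtStart) :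
    G.dir u v ∧ e.HeadAtEnd := by
  cases e with
  | forward hd => exact ⟨hd, trivial⟩
  | backward _ => exact absurd trivial h
  | bidirected _ => exact absurd trivial h

/-- Cuts a path at `u`. If it is entered by an arrowhead at `v`, then either it runs along directed
edges all the way to `u`, or the first edge with an arrowhead at its start creates a collider in
an(C), of which `v` is an ancestor. -/
lemma Walk.exists_suffix {C : Finset V} {u v w : V} (q : G.Walk v w) (hq : q.IsPath)
    (ho : q.Unblocked C) (hu : u ∈ q.support) (h : Prop) (hJ : q.Junction C h) :
    ∃ p : G.Walk u w, p.IsPath ∧ p.Unblocked C ∧ ∃ h' : Prop, p.Junction C h' ∧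
      (h → v ∈ G.an C ∨ (h' ∧ Relation.ReflTransGen G.dir v u)) := by
  induction q generalizing h with
  | nil v =>
    rw [Walk.support, List.mem_singleton] at hu
    subst hu
    exact ⟨.nil _, hq, ho, h, hJ, fun h => Or.inr ⟨h, Relation.ReflTransGen.refl⟩⟩
  | @cons v x w f q ih =>
    by_cases huv : u = v
    · subst huv
      exact ⟨.cons f q, hq, ho, h, hJ, fun h => Or.inr ⟨h, Relation.ReflTransGen.refl⟩⟩
    · have hu' : u ∈ q.support := by
        rw [Walk.support, List.mem_cons] at hu
        exact hu.resolve_left huv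
      have hq' : q.IsPath := by
        rw [Walk.IsPath, Walk.support, List.nodup_cons] at hq
        exact hq.2
      obtain ⟨p, hp, hpo, h', hJ', himp⟩ := ih hq' ho.2 hu' _ ho.1
      refine ⟨p, hp, hpo, h', hJ', fun hh => ?_⟩
      by_cases hf : f.HeadAtStart
      · exact Or.inl (hJ.1 ⟨hh, hf⟩)
      · obtain ⟨hd, he⟩ := Edge.of_not_headAtStart hf
        rcases himp he with h1 | h1
        · exact Or.inl (isAncestral_an C hd h1)
        · exact Or.inr ⟨h1.1, h1.2.head hd⟩

/-- An unblocked walk can be shortened to an unblocked path. -/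
lemma Walk.exists_path {C : Finset V} {u w : V} (p : G.Walk u w) (hp : p.Unblocked C) :
    ∃ q : G.Walk u w, q.IsPath ∧ q.Unblocked C ∧ ∀ h : Prop, p.Junction C h → q.Junction C h := by
  induction p with
  | nil v => exact ⟨.nil v, List.nodup_singleton v, trivial, fun _ h => h⟩
  | @cons u v w e p ih =>
    obtain ⟨q, hq, hqo, hqJ⟩ := ih hp.2
    by_cases hu : u ∈ q.support
    · obtain ⟨r, hr, hro, h', hJ', himp⟩ := q.exists_suffix hq hqo hu _ (hqJ _ hp.1)
      refine ⟨r, hr, hro, fun h hJ => ?_⟩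
      cases r with
      -- The excised loop may turn `u` into a collider. If the loop left `u` by a directed edge,
      -- that edge leads to an(C), or the loop came back to `u` with an arrowhead and `u` was a
      -- collider already.
      | nil => trivial
      | cons f r =>
        refine ⟨fun ⟨hh, hf⟩ => ?_, fun hn => ?_⟩
        · by_cases he : e.HeadAtStart
          · exact hJ.1 ⟨hh, he⟩
          · obtain ⟨hd, hend⟩ := Edge.of_not_headAtStart he
            rcases himp hend with h1 | h1
            · exact isAncestral_an C hd h1
            · exact hJ'.1 ⟨h1.1, hf⟩
        · by_cases h2 : h' ∧ f.HeadAtStart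
          · exact hJ.2 fun h3 => hn ⟨h3.1, h2.2⟩
          · exact hJ'.2 h2
    · exact ⟨.cons e q, List.nodup_cons.2 ⟨hu, hq⟩, ⟨hqJ _ hp.1, hqo⟩, fun _ h => h⟩

/-- m-separation speaks of paths only; shortening extends it to walks, which can be concatenated
freely. -/
lemma MSep.not_unblocked {A B C : Finset V} (h : G.MSep A B C) {a b : V} (ha : a ∈ A)
    (hb : b ∈ B) (p : G.Walk a b) : ¬ p.Unblocked C := by
  intro hp
  obtain ⟨q, hq, hqo, -⟩ := p.exists_path hp
  exact (q.not_blocked_iff C).2 hqo (h a ha b hb q hq)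

/-- On a directed path every interior vertex is a non-collider, and it is outside `C` because `d` is
not an ancestor of `C`. -/
lemma exists_forward_walk {C : Finset V} {d b : V} (hd : d ∉ G.an C)
    (h : Relation.ReflTransGen G.dir d b) :
    ∃ p : G.Walk d b, p.Unblocked C ∧ ∀ h : Prop, p.Junction C h := by
  induction h using Relation.ReflTransGen.head_induction_on with
  | refl => exact ⟨.nil b, trivial, fun _ => trivial⟩
  | head hac _ ih =>
    obtain ⟨p, hp, hJ⟩ := ih fun hc => hd (isAncestral_an C hac hc)
    exact ⟨.cons (.forward hac) p, ⟨hJ _, hp⟩,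
      fun _ => ⟨fun h => h.2.elim, fun _ hC => hd (subset_an C hC)⟩⟩

lemma exists_backward_walk {C : Finset V} {d a b : V} (hd : d ∉ G.an C)
    (h : Relation.ReflTransGen G.dir d a) (p : G.Walk d b) (hp : p.Unblocked C) :
    ∃ q : G.Walk a b, q.Unblocked C ∧ q.Junction C False := by
  induction h with
  | refl =>
    refine ⟨p, hp, ?_⟩
    cases p with
    | nil => trivial
    | cons f p => exact ⟨fun h => h.1.elim, fun _ hC => hd (subset_an C hC)⟩
  | tail hda hab ih =>
    obtain ⟨q, hq, hJ⟩ := ih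
    exact ⟨.cons (.backward hab) q, ⟨hJ, hq⟩,
      fun h => h.1.elim, fun _ hC => hd (G.mem_an.2 ⟨_, hC, hda.tail hab⟩)⟩

/-- There is an unblocked walk from `u` to `B` that stays unblocked when it is extended by an edge
with an arrowhead at `u`. -/
def Linked (G : ADMG V) (B C : Finset V) (u : V) : Prop :=
  ∃ b ∈ B, ∃ p : G.Walk u b, p.Unblocked C ∧ p.Junction C True

lemma MSep.linked {A B C : Finset V} (h : G.MSep A B C) {d b : V} (hd : d ∈ G.an (A ∪ B ∪ C))
    (hb : b ∈ B) (p : G.Walk d b) (hp : p.Unblocked C)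
    (hJ : d ∈ G.an C → p.Junction C True) : G.Linked B C d := by
  by_cases hdC : d ∈ G.an C
  · exact ⟨b, hb, p, hp, hJ hdC⟩
  · obtain ⟨v, hv, hdv⟩ := G.mem_an.1 hd
    rw [Finset.mem_union, Finset.mem_union] at hv
    rcases hv with (hv | hv) | hv
    · obtain ⟨q, hq, -⟩ := exists_backward_walk hdC hdv p hp
      exact absurd hq (h.not_unblocked hv hb q)
    · obtain ⟨q, hq, hqJ⟩ := exists_forward_walk hdC hdv
      exact ⟨v, hv, q, hq, hqJ _⟩
    · exact absurd (G.mem_an.2 ⟨v, hv, hdv⟩) hdC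

/-- m-separation is witnessed by a union of districts of the ancestral set. -/
lemma MSep.exists_isBiClosed {A B C : Finset V} (h : G.MSep A B C) :
    ∃ D, G.IsBiClosed (G.an (A ∪ B ∪ C)) D ∧ B ⊆ D ∧ Disjoint A D ∧
      (∀ d ∈ D, ∀ u, G.dir u d → u ∉ C → u ∈ D) ∧
      (∀ u ∈ D, u ∉ C → ∀ d ∈ G.an (A ∪ B ∪ C), G.dir u d → d ∈ D) := by
  classical
  -- The closure properties come from prepending one edge to a linking walk. A parent outside `C` is
  -- then a non-collider; a bidirected neighbour or a child is handled by `MSep.linked`, where a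
  -- vertex outside an(C) descends to `B`, or to `A` in contradiction to the separation.
  refine ⟨(G.an (A ∪ B ∪ C)).filter fun d => G.Linked B C d,
    ⟨Finset.filter_subset _ _, ?_⟩, ?_, ?_, ?_, ?_⟩
  · intro v hv w hw hvw
    obtain ⟨-, b, hb, p, hp, hJ⟩ := Finset.mem_filter.1 hv
    exact Finset.mem_filter.2 ⟨hw, h.linked hw hb (.cons (.bidirected hvw.symm) p) ⟨hJ, hp⟩
      fun hC => ⟨fun _ => hC, fun hn => absurd ⟨trivial, trivial⟩ hn⟩⟩
  · intro b hb
    exact Finset.mem_filter.2 ⟨subset_an _ (Finset.mem_union_left _ (Finset.mem_union_right _ hb)),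
      b, hb, .nil b, trivial, trivial⟩
  · rw [Finset.disjoint_left]
    intro a ha haD
    obtain ⟨-, b, hb, p, hp, -⟩ := Finset.mem_filter.1 haD
    exact h.not_unblocked ha hb p hp
  · intro d hd u hud hu
    obtain ⟨hdS, b, hb, p, hp, hJ⟩ := Finset.mem_filter.1 hd
    exact Finset.mem_filter.2 ⟨isAncestral_an _ hud hdS, b, hb, .cons (.forward hud) p,
      ⟨hJ, hp⟩, fun h => h.2.elim, fun _ => hu⟩
  · intro u hu huC d hd hud
    obtain ⟨huS, b, hb, p, hp, hJ⟩ := Finset.mem_filter.1 hu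
    refine Finset.mem_filter.2 ⟨hd, h.linked hd hb (.cons (.backward hud) p) ⟨?_, hp⟩
      fun hC => ⟨fun _ => hC, fun hn => absurd ⟨trivial, trivial⟩ hn⟩⟩
    cases p with
    | nil => trivial
    | cons f p => exact ⟨fun h => h.1.elim, fun _ => huC⟩

/-- No walk that is unblocked leads from a vertex outside an ancestral set, entered by an
arrowhead, back into the set. -/
lemma Walk.not_unblocked_of_notMem {S C : Finset V} (hS : G.IsAncestral S) (hC : C ⊆ S)
    {u b : V} (p : G.Walk u b) (hp : p.Unblocked C) (hJ : p.Junction C True) (hu : u ∉ S) :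
    b ∉ S := by
  induction p with
  | nil v => exact hu
  | @cons u v w e p ih =>
    by_cases he : e.HeadAtStart
    · exact absurd (hS.an_subset hC (hJ.1 ⟨trivial, he⟩)) hu
    · obtain ⟨hd, hend⟩ := Edge.of_not_headAtStart he
      refine ih hp.2 ?_ fun hv => hu (hS hd hv)
      have := hp.1
      rwa [eq_true hend] at this

/-- Such a walk cannot escape from `D` to `B`. A child of `u` forces `u ∈ A` and leads out of `S`
for good; a parent is a non-collider in `C`; a bidirected edge stays in `D` or leaves `S` for good.
-/
lemma Walk.not_unblocked_of_mem {S A B C D : Finset V} (hS : G.IsAncestral S)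
    (hABC : ∀ v, v ∈ S ↔ v ∈ A ∨ v ∈ B ∨ v ∈ C)
    (hD : G.IsBiClosed S D) (hDB : Disjoint D B) (hpa : Disjoint (G.pa D) B)
    (hA : ∀ a ∈ A, ∀ w ∈ S, ¬ G.dir a w) {u b : V} (hb : b ∈ B) (p : G.Walk u b)
    (hp : p.Unblocked C) (hu : u ∈ D) (hJ : p.Junction C True) (huAC : u ∈ A ∨ u ∈ C) : False := by
  have hCS : C ⊆ S := fun v hv => (hABC v).2 (Or.inr (Or.inr hv))
  have hbS : b ∈ S := (hABC b).2 (Or.inr (Or.inl hb))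
  induction p with
  | nil v => exact Finset.disjoint_left.1 hDB hu hb
  | @cons u x w e p ih =>
    cases e with
    | forward h =>
      have huA : u ∈ A := huAC.resolve_right (hJ.2 fun h => h.2)
      exact p.not_unblocked_of_notMem hS hCS hp.2 hp.1 (fun hx => hA u huA x hx h) hbS
    | backward h =>
      have hxS : x ∈ S := hS h (hD.1 hu)
      have hxB : x ∉ B := Finset.disjoint_left.1 hpa (mem_pa.2 ⟨u, hu, h⟩)
      have hxC : x ∈ C := (((hABC x).1 hxS).resolve_left
        fun hxA => hA x hxA u (hD.1 hu) h).resolve_left hxB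
      cases p with
      | nil => exact hxB hb
      | cons f p => exact hp.1.2 (fun h => h.1) hxC
    | bidirected h =>
      by_cases hxS : x ∈ S
      · have hxD : x ∈ D := hD.2 u hu x hxS h
        refine ih hb hp.2 hxD hp.1 ?_ hbS
        have hxB := Finset.disjoint_left.1 hDB hxD
        have := (hABC x).1 hxS
        tauto
      · exact p.not_unblocked_of_notMem hS hCS hp.2 hp.1 hxS hbS

/-- Childless vertices of a union of districts of an ancestral set are m-separated from the
vertices outside of it and of its parents. -/
lemma mSep_of_isBiClosed {S A B C D : Finset V} (hS : G.IsAncestral S)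
    (hABC : ∀ v, v ∈ S ↔ v ∈ A ∨ v ∈ B ∨ v ∈ C)
    (hD : G.IsBiClosed S D) (hDB : Disjoint D B) (hpa : Disjoint (G.pa D) B)
    (hA : ∀ a ∈ A, ∀ w ∈ S, ¬ G.dir a w) (hAD : A ⊆ D) : G.MSep A B C := by
  intro a ha b hb p _
  by_contra hbl
  have hp := (p.not_blocked_iff C).1 hbl
  have hCS : C ⊆ S := fun v hv => (hABC v).2 (Or.inr (Or.inr hv))
  have hbS : b ∈ S := (hABC b).2 (Or.inr (Or.inl hb))
  have haD := hAD ha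
  cases p with
  | nil => exact Finset.disjoint_left.1 hDB haD hb
  | @cons _ x _ e p =>
    have hout : x ∉ S → p.Junction C True → False := fun hxS hJ =>
      p.not_unblocked_of_notMem hS hCS hp.2 hJ hxS hbS
    cases e with
    | forward h => exact hout (fun hx => hA a ha x hx h) hp.1
    | backward h =>
      have hxS : x ∈ S := hS h (hD.1 haD)
      have hxB : x ∉ B := Finset.disjoint_left.1 hpa (mem_pa.2 ⟨a, haD, h⟩)
      have hxC : x ∈ C := (((hABC x).1 hxS).resolve_left
        fun hxA => hA x hxA a (hD.1 haD) h).resolve_left hxB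
      cases p with
      | nil => exact hxB hb
      | cons f p => exact hp.1.2 (fun h => h.1) hxC
    | bidirected h =>
      by_cases hxS : x ∈ S
      · have hxD : x ∈ D := hD.2 a haD x hxS h
        refine p.not_unblocked_of_mem hS hABC hD hDB hpa hA hb hp.2 hxD hp.1 ?_
        have hxB := Finset.disjoint_left.1 hDB hxD
        have := (hABC x).1 hxS
        tauto
      · exact hout hxS hp.1

end Paths

end ADMG

/-! ### Marginal sums and conditional independence of positive vectors. -/

section Marginals

set_option linter.unusedSectionVars false

variable {V : Type*} [Fintype V] [DecidableEq V]

/-! ### Summing out coordinates -/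

/-- The sum of `f` over all vectors that agree with `i` outside `E`. -/
noncomputable def marg (f : (V → Fin 2) → ℝ) (E : Finset V) (i : V → Fin 2) : ℝ :=
  ∑ j with ∀ v, v ∉ E → j v = i v, f j

lemma evPr_eq_marg (p : (V → Fin 2) → ℝ) (W : Finset V) (i : V → Fin 2) :
    evPr p (fun x => ∀ v ∈ W, x v = i v) = marg p Wᶜ i := by
  unfold evPr marg
  refine Finset.sum_congr ?_ fun _ _ => rfl
  ext x
  simp

lemma marg_univ (f : (V → Fin 2) → ℝ) (i : V → Fin 2) : marg f Finset.univ i = ∑ j, f j := by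
  simp [marg]

lemma marg_empty (f : (V → Fin 2) → ℝ) (i : V → Fin 2) : marg f ∅ i = f i := by
  unfold marg
  rw [Finset.sum_eq_single i]
  · intro j hj hne
    exact absurd (funext fun v => (Finset.mem_filter.1 hj).2 v (by simp)) hne
  · intro h
    exact absurd (Finset.mem_filter.2 ⟨Finset.mem_univ _, fun _ _ => rfl⟩) h

lemma marg_pos {p : (V → Fin 2) → ℝ} (hp : ∀ x, 0 < p x) (E : Finset V) (i : V → Fin 2) :
    0 < marg p E i :=
  Finset.sum_pos (fun x _ => hp x) ⟨i, by simp⟩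

lemma marg_union {f : (V → Fin 2) → ℝ} {E E' : Finset V} (h : Disjoint E E') (i : V → Fin 2) :
    marg f (E ∪ E') i = marg (fun j => marg f E' j) E i := by
  unfold marg
  rw [Finset.sum_sigma']
  refine Finset.sum_nbij' (fun j => ⟨E.piecewise j i, j⟩) (fun k => k.2) ?_ ?_ ?_ ?_ ?_
  · intro j hj
    rw [Finset.mem_filter] at hj
    simp only [Finset.mem_sigma, Finset.mem_filter, Finset.mem_univ, true_and]
    refine ⟨fun v hv => Finset.piecewise_eq_of_notMem _ _ _ hv, fun v hv => ?_⟩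
    by_cases hE : v ∈ E
    · rw [Finset.piecewise_eq_of_mem _ _ _ hE]
    · rw [Finset.piecewise_eq_of_notMem _ _ _ hE]
      exact hj.2 v (by simp [hE, hv])
  · rintro ⟨k, j⟩ hk
    simp only [Finset.mem_sigma, Finset.mem_filter, Finset.mem_univ, true_and] at hk ⊢
    intro v hv
    rw [Finset.mem_union, not_or] at hv
    rw [hk.2 v hv.2, hk.1 v hv.1]
  · intro j _
    rfl
  · rintro ⟨k, j⟩ hk
    simp only [Finset.mem_sigma, Finset.mem_filter, Finset.mem_univ, true_and] at hk
    have : E.piecewise j i = k := by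
      ext1 v
      by_cases hE : v ∈ E
      · rw [Finset.piecewise_eq_of_mem _ _ _ hE, hk.2 v (Finset.disjoint_left.1 h hE)]
      · rw [Finset.piecewise_eq_of_notMem _ _ _ hE, hk.1 v hE]
    simp only [this]
  · intro j _
    rfl

lemma marg_singleton (f : (V → Fin 2) → ℝ) (v : V) (i : V → Fin 2) :
    marg f {v} i = f (Function.update i v 0) + f (Function.update i v 1) := by
  have hne : Function.update i v (0 : Fin 2) ≠ Function.update i v 1 := fun h => by
    simpa using congrFun h v
  rw [← Finset.sum_pair hne]
  unfold marg
  refine Finset.sum_congr ?_ fun _ _ => rfl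
  ext j
  simp only [Finset.mem_filter, Finset.mem_univ, true_and, Finset.mem_singleton,
    Finset.mem_insert, Function.eq_update_iff]
  constructor
  · intro h
    rcases Fin.exists_fin_two.1 ⟨j v, rfl⟩ with h0 | h0
    · exact Or.inl ⟨h0, h⟩
    · exact Or.inr ⟨h0, h⟩
  · rintro (h | h) <;> exact h.2

lemma marg_insert {f : (V → Fin 2) → ℝ} {E : Finset V} {v : V} (hv : v ∉ E) (i : V → Fin 2) :
    marg f (insert v E) i =
      marg f E (Function.update i v 0) + marg f E (Function.update i v 1) := by
  rw [Finset.insert_eq, marg_union (Finset.disjoint_singleton_left.2 hv), marg_singleton]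

lemma DependsOn.marg {f : (V → Fin 2) → ℝ} {T : Set V} (hf : DependsOn f T) (E : Finset V) :
    DependsOn (marg f E) (T \ E) := by
  intro i i' h
  unfold _root_.marg
  refine Finset.sum_nbij' (fun j => E.piecewise j i') (fun j => E.piecewise j i) ?_ ?_ ?_ ?_ ?_
  · intro j _
    exact Finset.mem_filter.2 ⟨Finset.mem_univ _,
      fun v hv => Finset.piecewise_eq_of_notMem _ _ _ hv⟩
  · intro j _
    exact Finset.mem_filter.2 ⟨Finset.mem_univ _,
      fun v hv => Finset.piecewise_eq_of_notMem _ _ _ hv⟩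
  · intro j hj
    ext1 v
    by_cases hE : v ∈ E
    · simp [hE]
    · simp [hE, (Finset.mem_filter.1 hj).2 v hE]
  · intro j hj
    ext1 v
    by_cases hE : v ∈ E
    · simp [hE]
    · simp [hE, (Finset.mem_filter.1 hj).2 v hE]
  · intro j hj
    refine hf fun v hv => ?_
    by_cases hE : v ∈ E
    · simp [hE]
    · rw [Finset.piecewise_eq_of_notMem _ _ _ hE, (Finset.mem_filter.1 hj).2 v hE]
      exact h v ⟨hv, hE⟩

lemma marg_mul_left {g h : (V → Fin 2) → ℝ} {T : Set V} (hg : DependsOn g T) {E : Finset V}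
    (hE : ∀ v ∈ E, v ∉ T) (i : V → Fin 2) :
    marg (fun j => g j * h j) E i = g i * marg h E i := by
  unfold marg
  rw [Finset.mul_sum]
  refine Finset.sum_congr rfl fun j hj => ?_
  change g j * h j = _
  rw [hg fun v hv => (Finset.mem_filter.1 hj).2 v fun hvE => hE v hvE hv]

lemma marg_mul {g h : (V → Fin 2) → ℝ} {T T' : Set V} (hg : DependsOn g T) (hh : DependsOn h T')
    {E E' : Finset V} (hE : ∀ v ∈ E, v ∉ T') (hE' : ∀ v ∈ E', v ∉ T) (hd : Disjoint E E')
    (i : V → Fin 2) :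
    marg (fun j => g j * h j) (E ∪ E') i = marg g E i * marg h E' i := by
  rw [marg_union hd]
  simp only [marg_mul_left hg hE']
  simp only [mul_comm (g _)]
  rw [marg_mul_left (hh.marg E') (fun v hv h => hE v hv h.1), mul_comm]

/-! ### Conditional independence -/

lemma condIndepVars_iff {p : (V → Fin 2) → ℝ} (hp : ∀ x, 0 < p x) (A B C : Finset V) :
    CondIndepVars p A B C ↔ ∀ i, marg p (A ∪ B ∪ C)ᶜ i * marg p Cᶜ i =
      marg p (A ∪ C)ᶜ i * marg p (B ∪ C)ᶜ i := by
  refine forall_congr' fun i => ?_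
  have h1 : evPr p (fun x => ((∀ v ∈ A, x v = i v) ∧ ∀ v ∈ B, x v = i v) ∧ ∀ v ∈ C, x v = i v) =
      marg p (A ∪ B ∪ C)ᶜ i := by
    rw [← evPr_eq_marg]
    congr 1
    ext x
    simp only [Finset.forall_mem_union]
  have h2 : ∀ A : Finset V, evPr p (fun x => (∀ v ∈ A, x v = i v) ∧ ∀ v ∈ C, x v = i v) =
      marg p (A ∪ C)ᶜ i := by
    intro A
    rw [← evPr_eq_marg]
    congr 1
    ext x
    simp only [Finset.forall_mem_union]
  unfold evCondPr
  rw [h1, h2, h2, evPr_eq_marg]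
  have hC := (marg_pos hp Cᶜ i).ne'
  rw [div_mul_div_comm, div_eq_div_iff hC (mul_ne_zero hC hC), ← mul_assoc]
  exact ⟨fun h => mul_right_cancel₀ hC h, fun h => by rw [h]⟩

/-- A factorization of a marginal distribution entails a conditional independence. -/
lemma condIndepVars_of_factorization {p g h : (V → Fin 2) → ℝ} (hp : ∀ x, 0 < p x)
    {A B C U R : Finset V} (hUR : Disjoint U R) (hUC : Disjoint U C) (hRC : Disjoint R C)
    (hBU : B ⊆ U) (hAR : A ⊆ R) (hg : DependsOn g (U ∪ C : Finset V))
    (hh : DependsOn h (R ∪ C : Finset V))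
    (hf : ∀ i, marg p (U ∪ R ∪ C)ᶜ i = g i * h i) : CondIndepVars p A B C := by
  rw [condIndepVars_iff hp]
  -- Each of the four marginals in the independence sums out some `U'` from `g` and some `R'` from
  -- `h`; the resulting products then agree by commutativity.
  have key : ∀ U' R', U' ⊆ U → R' ⊆ R → ∀ W, Wᶜ = U' ∪ R' ∪ (U ∪ R ∪ C)ᶜ → ∀ i,
      marg p Wᶜ i = marg g U' i * marg h R' i := by
    intro U' R' hU' hR' W hW i
    have hd : Disjoint (U' ∪ R') (U ∪ R ∪ C)ᶜ :=
      (disjoint_compl_right (a := U ∪ R ∪ C)).mono_left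
        ((Finset.union_subset_union hU' hR').trans Finset.subset_union_left)
    rw [hW, marg_union hd]
    simp only [hf]
    refine marg_mul hg hh ?_ ?_ (hUR.mono hU' hR') i
    · intro v hv hv'
      rcases Finset.mem_union.1 (Finset.mem_coe.1 hv') with h | h
      · exact Finset.disjoint_left.1 hUR (hU' hv) h
      · exact Finset.disjoint_left.1 hUC (hU' hv) h
    · intro v hv hv'
      rcases Finset.mem_union.1 (Finset.mem_coe.1 hv') with h | h
      · exact Finset.disjoint_left.1 hUR h (hR' hv)
      · exact Finset.disjoint_left.1 hRC (hR' hv) h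
  have mem : ∀ v, (v ∈ U → v ∉ R) ∧ (v ∈ U → v ∉ C) ∧ (v ∈ R → v ∉ C) ∧ (v ∈ B → v ∈ U) ∧
      (v ∈ A → v ∈ R) := fun v => ⟨fun h => Finset.disjoint_left.1 hUR h,
    fun h => Finset.disjoint_left.1 hUC h, fun h => Finset.disjoint_left.1 hRC h,
    fun h => hBU h, fun h => hAR h⟩
  intro i
  rw [key (U \ B) (R \ A) Finset.sdiff_subset Finset.sdiff_subset (A ∪ B ∪ C) ?_ i,
    key U R Finset.Subset.rfl Finset.Subset.rfl C ?_ i,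
    key U (R \ A) Finset.Subset.rfl Finset.sdiff_subset (A ∪ C) ?_ i,
    key (U \ B) R Finset.sdiff_subset Finset.Subset.rfl (B ∪ C) ?_ i]
  · ring
  all_goals
    ext v
    have := mem v
    simp only [Finset.mem_compl, Finset.mem_union, Finset.mem_sdiff]
    grind

end Marginals

namespace ADMG

/-! ### Factorization, marginalization and splitting of the parametrization. -/

section Parametrization

set_option linter.unusedSectionVars false

variable {V : Type*} [Fintype V] [DecidableEq V] {G : ADMG V}

/-! ### The parametrization on subsets of the vertices -/

/-- The Möbius coefficient of `C ⊆ S`: it is `(-1) ^ |C \ O|` if `C` contains the set `O` of the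
zeros of `x` in `S`, and `0` otherwise. -/
noncomputable def mobiusCoeff (S C : Finset V) (x : V → Fin 2) : ℝ :=
  (∏ v ∈ C, if x v = 0 then 1 else -1) * ∏ v ∈ S \ C, if x v = 0 then 0 else 1

/-- The product of the parameters of the heads in `[C]`. -/
noncomputable def headProd (q : G.ParamIndex → ℝ) (C : Finset V) (x : V → Fin 2) : ℝ :=
  ∏ H : G.heads with H.1 ∈ G.partition C, q ⟨H, fun v => x v⟩

/-- The analogue of `pMap` for a subset `S` of the vertices. -/
noncomputable def subsetMap (q : G.ParamIndex → ℝ) (S : Finset V) (x : V → Fin 2) : ℝ :=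
  ∑ C ∈ S.powerset, mobiusCoeff S C x * headProd q C x

lemma pMap_eq_subsetMap (q : G.ParamIndex → ℝ) : G.pMap q = subsetMap q Finset.univ := by
  ext i
  unfold pMap subsetMap
  rw [Finset.powerset_univ, Finset.sum_filter]
  refine Finset.sum_congr rfl fun C _ => ?_
  unfold mobiusCoeff
  split_ifs with h
  · have h1 : ∏ v ∈ Finset.univ \ C, (if i v = 0 then (0 : ℝ) else 1) = 1 := by
      refine Finset.prod_eq_one fun v hv => if_neg fun h0 => ?_
      exact (Finset.mem_sdiff.1 hv).2 (h (by simp [zeros, h0]))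
    have h2 : C \ zeros i = C.filter fun v => ¬ i v = 0 := by
      ext v
      simp [zeros]
    rw [h1, mul_one, Finset.prod_ite, h2]
    simp [headProd]
  · obtain ⟨v, hv, hvC⟩ := Finset.not_subset.1 h
    rw [Finset.prod_eq_zero (i := v) (s := Finset.univ \ C) (by simp [hvC])]
    · simp
    · simp only [zeros, Finset.mem_filter, Finset.mem_univ, true_and] at hv
      exact if_pos hv

lemma subsetMap_empty (q : G.ParamIndex → ℝ) (x : V → Fin 2) : subsetMap q ∅ x = 1 := by
  simp [subsetMap, mobiusCoeff, headProd, partition_empty]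

lemma headProd_union (q : G.ParamIndex → ℝ) {C C₁ C₂ : Finset V} (x : V → Fin 2)
    (hd : Disjoint C₁ C₂) (h : G.partition C = G.partition C₁ ∪ G.partition C₂) :
    headProd q C x = headProd q C₁ x * headProd q C₂ x := by
  unfold headProd
  rw [← Finset.prod_union, ← Finset.filter_or]
  · refine Finset.prod_congr (Finset.filter_congr fun H _ => ?_) fun _ _ => rfl
    rw [h, Finset.mem_union]
  · rw [Finset.disjoint_filter]
    exact fun H _ h1 => Finset.disjoint_left.1 (disjoint_partition hd) h1

lemma headProd_of_mem_maxHeads (q : G.ParamIndex → ℝ) {C M : Finset V} (x : V → Fin 2)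
    (hM : M ∈ G.maxHeads C) :
    headProd q C x =
      q ⟨⟨M, mem_heads.2 (mem_maxHeads.1 hM).1⟩, fun v => x v⟩ * headProd q (C \ M) x := by
  unfold headProd
  have hnot : M ∉ G.partition (C \ M) := by
    intro h
    obtain ⟨⟨⟨v, hv⟩, -⟩, hsub⟩ := partition_spec _ M h
    exact (Finset.mem_sdiff.1 (hsub hv)).2 hv
  rw [← Finset.prod_insert (f := fun H : G.heads => q ⟨H, fun v => x v⟩)
    (a := ⟨M, mem_heads.2 (mem_maxHeads.1 hM).1⟩)]
  · refine Finset.prod_congr ?_ fun _ _ => rfl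
    ext H
    simp [partition_eq_insert hM, Subtype.ext_iff]
  · simpa using hnot

lemma headProd_congr (q : G.ParamIndex → ℝ) {C : Finset V} {x y : V → Fin 2}
    (h : ∀ H, G.IsHead H → H ⊆ C → ∀ v ∈ G.tail H, x v = y v) :
    headProd q C x = headProd q C y := by
  unfold headProd
  refine Finset.prod_congr rfl fun H hH => ?_
  obtain ⟨h1, h2⟩ := partition_spec _ _ (Finset.mem_filter.1 hH).2
  have : (fun v : G.tail H.1 => x v) = fun v : G.tail H.1 => y v := funext fun v => h _ h1 h2 v v.2
  rw [this]

lemma mobiusCoeff_congr {S C : Finset V} {x y : V → Fin 2} (hC : C ⊆ S)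
    (h : ∀ v ∈ S, x v = y v) : mobiusCoeff S C x = mobiusCoeff S C y := by
  unfold mobiusCoeff
  congr 1
  · exact Finset.prod_congr rfl fun v hv => by rw [h v (hC hv)]
  · exact Finset.prod_congr rfl fun v hv => by rw [h v (Finset.mem_sdiff.1 hv).1]

lemma mobiusCoeff_mul {S C D : Finset V} (x : V → Fin 2) :
    mobiusCoeff S C x = mobiusCoeff (S ∩ D) (C ∩ D) x * mobiusCoeff (S \ D) (C \ D) x := by
  unfold mobiusCoeff
  have h1 : (S ∩ D) \ (C ∩ D) = (S \ C) ∩ D := by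
    ext v
    simp only [Finset.mem_sdiff, Finset.mem_inter]
    tauto
  have h2 : (S \ D) \ (C \ D) = (S \ C) \ D := by
    ext v
    simp only [Finset.mem_sdiff]
    tauto
  rw [h1, h2, ← Finset.prod_inter_mul_prod_sdiff C D, ← Finset.prod_inter_mul_prod_sdiff (S \ C) D]
  ring

/-- The parametrization factorizes along districts. -/
lemma subsetMap_mul (q : G.ParamIndex → ℝ) {S D : Finset V} (hS : G.IsAncestral S)
    (hD : G.IsBiClosed S D) (x : V → Fin 2) :
    subsetMap q S x = subsetMap q D x * subsetMap q (S \ D) x := by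
  unfold subsetMap
  rw [Finset.sum_mul_sum, ← Finset.sum_product']
  refine Finset.sum_nbij' (fun C => (C ∩ D, C \ D)) (fun C => C.1 ∪ C.2) ?_ ?_ ?_ ?_ ?_
  · intro C hC
    rw [Finset.mem_powerset] at hC
    simp only [Finset.mem_product, Finset.mem_powerset]
    exact ⟨Finset.inter_subset_right, Finset.sdiff_subset_sdiff hC Finset.Subset.rfl⟩
  · rintro ⟨C₁, C₂⟩ hC
    simp only [Finset.mem_product, Finset.mem_powerset] at hC ⊢
    exact Finset.union_subset (hC.1.trans hD.1) (hC.2.trans Finset.sdiff_subset)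
  · intro C _
    ext v
    simp only [Finset.mem_union, Finset.mem_inter, Finset.mem_sdiff]
    tauto
  · rintro ⟨C₁, C₂⟩ hC
    simp only [Finset.mem_product, Finset.mem_powerset] at hC
    ext v
    · have h1 := @hC.1 v
      have h2 := @hC.2 v
      simp only [Finset.mem_union, Finset.mem_inter, Finset.mem_sdiff] at h2 ⊢
      tauto
    · have h1 := @hC.1 v
      have h2 := @hC.2 v
      simp only [Finset.mem_union, Finset.mem_sdiff] at h2 ⊢
      tauto
  · intro C hC
    rw [Finset.mem_powerset] at hC
    rw [mobiusCoeff_mul (D := D), Finset.inter_eq_right.2 hD.1,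
      headProd_union q x (Finset.disjoint_left.2 fun v h1 h2 =>
        (Finset.mem_sdiff.1 h2).2 (Finset.mem_inter.1 h1).2) (partition_union hS hD C hC)]
    ring

lemma dependsOn_subsetMap (q : G.ParamIndex → ℝ) {S D : Finset V} (hS : G.IsAncestral S)
    (hD : G.IsBiClosed S D) : DependsOn (subsetMap q D) (D ∪ G.pa D : Finset V) := by
  intro x y h
  unfold subsetMap
  refine Finset.sum_congr rfl fun C hC => ?_
  rw [Finset.mem_powerset] at hC
  rw [mobiusCoeff_congr hC fun v hv => h v (Finset.mem_coe.2 (Finset.mem_union_left _ hv)),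
    headProd_congr q fun H _ hHC v hv =>
      h v (Finset.mem_coe.2 (tail_subset hS hD (hHC.trans hC) hv))]

/-- No tail contains `v`, so only the signs change. Subsets containing `v` enter with opposite signs
for the two values of `v` and cancel; those without `v` enter only for the value 1. -/
lemma subsetMap_update (q : G.ParamIndex → ℝ) {S : Finset V} {v : V}
    (hS : G.IsAncestral (insert v S)) (hvS : v ∉ S) (hv : ∀ w ∈ insert v S, ¬ G.dir v w)
    (x : V → Fin 2) :
    subsetMap q (insert v S) (Function.update x v 0) +
      subsetMap q (insert v S) (Function.update x v 1) = subsetMap q S x := by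
  unfold subsetMap
  have key : ∀ a : Fin 2, ∀ C ∈ S.powerset,
      mobiusCoeff (insert v S) C (Function.update x v a) *
        headProd q C (Function.update x v a) =
      (if a = 0 then 0 else 1) * (mobiusCoeff S C x * headProd q C x) ∧
      mobiusCoeff (insert v S) (insert v C) (Function.update x v a) *
        headProd q (insert v C) (Function.update x v a) =
      (if a = 0 then 1 else -1) * (mobiusCoeff S C x * headProd q (insert v C) x) := by
    intro a C hC
    rw [Finset.mem_powerset] at hC
    have hvC : v ∉ C := fun h => hvS (hC h)
    have hne : ∀ w, w ∈ S → Function.update x v a w = x w := fun w hw =>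
      Function.update_of_ne (fun h : w = v => hvS (h ▸ hw)) _ _
    have hh : ∀ C', C' ⊆ insert v S → headProd q C' (Function.update x v a) =
        headProd q C' x := by
      intro C' hC'
      refine headProd_congr q fun H _ hHC w hw => Function.update_of_ne ?_ _ _
      rintro rfl
      exact not_mem_tail hS (hHC.trans hC') hv hw
    rw [hh C (hC.trans (Finset.subset_insert _ _)), hh _ (Finset.insert_subset_insert v hC)]
    have e1 : ∏ w ∈ C, (if Function.update x v a w = 0 then (1 : ℝ) else -1) =
        ∏ w ∈ C, if x w = 0 then 1 else -1 :=
      Finset.prod_congr rfl fun w hw => by rw [hne w (hC hw)]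
    have e2 : ∏ w ∈ S \ C, (if Function.update x v a w = 0 then (0 : ℝ) else 1) =
        ∏ w ∈ S \ C, if x w = 0 then 0 else 1 :=
      Finset.prod_congr rfl fun w hw => by rw [hne w (Finset.mem_sdiff.1 hw).1]
    unfold mobiusCoeff
    constructor
    · rw [Finset.insert_sdiff_of_notMem _ hvC,
        Finset.prod_insert fun h => hvS (Finset.mem_sdiff.1 h).1, e1, e2, Function.update_self]
      ring
    · rw [Finset.insert_sdiff_insert, Finset.sdiff_insert_of_notMem hvS,
        Finset.prod_insert hvC, e1, e2, Function.update_self]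
      ring
  rw [Finset.sum_powerset_insert hvS, Finset.sum_powerset_insert hvS,
    Finset.sum_congr rfl fun C hC => (key 0 C hC).1, Finset.sum_congr rfl fun C hC => (key 0 C hC).2,
    Finset.sum_congr rfl fun C hC => (key 1 C hC).1, Finset.sum_congr rfl fun C hC => (key 1 C hC).2]
  simp

/-- If `x` vanishes on a head, then its parameter can be split off. -/
lemma subsetMap_an (q : G.ParamIndex → ℝ) {H : Finset V} (hH : H ∈ G.heads) {x : V → Fin 2}
    (hx : ∀ v ∈ H, x v = 0) :
    subsetMap q (G.an H) x = q ⟨⟨H, hH⟩, fun v => x v⟩ * subsetMap q (G.an H \ H) x := by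
  unfold subsetMap
  rw [Finset.mul_sum]
  symm
  -- As `x` vanishes on `H`, only subsets containing `H` contribute; in each of them `H` is a
  -- maximal head.
  refine Finset.sum_of_injOn (fun C => C ∪ H) ?_ ?_ ?_ ?_
  · intro C hC C' hC' h
    simp only [Finset.coe_powerset, Set.mem_preimage, Set.mem_powerset_iff,
      Finset.coe_subset] at hC hC'
    have hd : ∀ C, C ⊆ G.an H \ H → (C ∪ H) \ H = C := fun C hC => by
      rw [Finset.union_sdiff_right, Finset.sdiff_eq_self_of_disjoint]
      exact Finset.disjoint_left.2 fun v hv => (Finset.mem_sdiff.1 (hC hv)).2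
    rw [← hd C hC, ← hd C' hC']
    exact congrArg (· \ H) h
  · intro C hC
    simp only [Finset.coe_powerset, Set.mem_preimage, Set.mem_powerset_iff,
      Finset.coe_subset] at hC ⊢
    exact Finset.union_subset (hC.trans Finset.sdiff_subset) (subset_an H)
  · intro C hC hC'
    rw [Finset.mem_powerset] at hC
    have : ¬ H ⊆ C := by
      intro hHC
      refine hC' ⟨C \ H, ?_, Finset.sdiff_union_of_subset hHC⟩
      simp only [Finset.coe_powerset, Set.mem_preimage, Set.mem_powerset_iff, Finset.coe_subset]
      exact Finset.sdiff_subset_sdiff hC Finset.Subset.rfl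
    obtain ⟨v, hv, hvC⟩ := Finset.not_subset.1 this
    have h0 : ∏ v ∈ G.an H \ C, (if x v = 0 then (0 : ℝ) else 1) = 0 :=
      Finset.prod_eq_zero (Finset.mem_sdiff.2 ⟨subset_an H hv, hvC⟩) (if_pos (hx v hv))
    rw [mobiusCoeff, h0, mul_zero, zero_mul]
  · intro C hC
    rw [Finset.mem_powerset] at hC
    have hdisj : Disjoint C H :=
      Finset.disjoint_left.2 fun v hv => (Finset.mem_sdiff.1 (hC hv)).2
    have hmax : H ∈ G.maxHeads (C ∪ H) := (mem_heads.1 hH).mem_maxHeads Finset.subset_union_right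
      (Finset.union_subset (hC.trans Finset.sdiff_subset) (subset_an H))
    have hsd : (C ∪ H) \ H = C := by
      rw [Finset.union_sdiff_right, Finset.sdiff_eq_self_of_disjoint hdisj]
    have hsd' : G.an H \ (C ∪ H) = (G.an H \ H) \ C := by
      rw [Finset.union_comm, sdiff_sdiff_left, Finset.sup_eq_union]
    rw [headProd_of_mem_maxHeads q x hmax, hsd]
    unfold mobiusCoeff
    rw [hsd', Finset.prod_union hdisj,
      Finset.prod_eq_one (s := H) fun v hv => if_pos (hx v hv)]
    ring

/-- The marginals of the parametrization over ancestral sets. -/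
lemma marg_subsetMap (q : G.ParamIndex → ℝ) {S : Finset V} (hS : G.IsAncestral S)
    (T : Finset V) (hT : G.IsAncestral T) (hST : S ⊆ T) (i : V → Fin 2) :
    marg (subsetMap q T) (T \ S) i = subsetMap q S i := by
  induction T using Finset.strongInduction with
  | _ T ih =>
    rcases (T \ S).eq_empty_or_nonempty with h | ⟨u, hu⟩
    · rw [h, marg_empty, Finset.Subset.antisymm hST (Finset.sdiff_eq_empty_iff_subset.1 h)]
    obtain ⟨v, hv, -⟩ := exists_mem_barren (G := G) hu
    obtain ⟨hvT, hvS⟩ := Finset.mem_sdiff.1 (barren_subset _ hv)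
    -- A child in `S` would put `v` in `S`, and a child in `T \ S` contradicts barrenness.
    have hch : ∀ w ∈ T, ¬ G.dir v w := by
      intro w hw hvw
      by_cases hwS : w ∈ S
      · exact hvS (hS hvw hwS)
      · exact not_dir_of_mem_barren hv (Finset.mem_sdiff.2 ⟨hw, hwS⟩) hvw
    have hanc : G.IsAncestral (T.erase v) := by
      rw [Finset.erase_eq]
      exact hT.sdiff fun k hk => by rwa [Finset.mem_singleton.1 hk]
    have hsub : S ⊆ T.erase v := fun w hw =>
      Finset.mem_erase.2 ⟨fun h => hvS (h ▸ hw), hST hw⟩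
    have hset : T \ S = (T.erase v \ S) ∪ {v} := by
      ext w
      simp only [Finset.mem_sdiff, Finset.mem_union, Finset.mem_erase, Finset.mem_singleton]
      by_cases h : w = v
      · subst h; tauto
      · tauto
    have hdisj : Disjoint (T.erase v \ S) {v} := by simp
    rw [hset, marg_union hdisj, ← ih _ (Finset.erase_ssubset hvT) hanc hsub]
    congr 1
    ext j
    rw [marg_singleton]
    have := subsetMap_update q (S := T.erase v) (v := v) (by rwa [Finset.insert_erase hvT])
      (Finset.notMem_erase v T) (by rwa [Finset.insert_erase hvT]) j
    rwa [Finset.insert_erase hvT] at this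

lemma marg_pMap (q : G.ParamIndex → ℝ) {S : Finset V} (hS : G.IsAncestral S) (i : V → Fin 2) :
    marg (G.pMap q) Sᶜ i = subsetMap q S i := by
  rw [pMap_eq_subsetMap, Finset.compl_eq_univ_sdiff,
    marg_subsetMap q hS _ isAncestral_univ (Finset.subset_univ S)]

end Parametrization

end ADMG

namespace ADMG

/-! ### The two maps are mutually inverse. -/

section Model

set_option linter.unusedSectionVars false

variable {V : Type*} [Fintype V] [DecidableEq V] {G : ADMG V}

/-! ### Positive parametrized vectors belong to the model -/

lemma sum_pMap (q : G.ParamIndex → ℝ) : ∑ x, G.pMap q x = 1 := by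
  have h := marg_pMap q (S := ∅) (fun _ _ _ h => absurd h (Finset.notMem_empty _)) 0
  rwa [Finset.compl_empty, marg_univ, subsetMap_empty] at h

/-- The factors for `D` and `S \ D` depend on their own vertices and on parents, and by the choice
of `D` any parent on the other side lies in `C`. -/
lemma globalMarkov_pMap {q : G.ParamIndex → ℝ} (hq : ∀ x, 0 < G.pMap q x) :
    G.GlobalMarkov (G.pMap q) := by
  intro A B C _ hAC hBC _ _ hsep
  obtain ⟨D, hD, hBD, hAD, hpa, hch⟩ := hsep.exists_isBiClosed
  have hS : G.IsAncestral (G.an (A ∪ B ∪ C)) := isAncestral_an _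
  have hCS : ∀ v, v ∈ C → v ∈ G.an (A ∪ B ∪ C) := fun v hv =>
    subset_an _ (Finset.mem_union_right _ hv)
  have hAS : ∀ v, v ∈ A → v ∈ G.an (A ∪ B ∪ C) := fun v hv =>
    subset_an _ (Finset.mem_union_left _ (Finset.mem_union_left _ hv))
  set S := G.an (A ∪ B ∪ C)
  refine condIndepVars_of_factorization hq (U := D \ C) (R := (S \ D) \ C)
    (g := subsetMap q D) (h := subsetMap q (S \ D)) ?_ Finset.sdiff_disjoint
    Finset.sdiff_disjoint ?_ ?_ ?_ ?_ ?_
  · exact Finset.disjoint_left.2 fun v h1 h2 =>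
      (Finset.mem_sdiff.1 (Finset.mem_sdiff.1 h2).1).2 (Finset.mem_sdiff.1 h1).1
  · exact fun v hv => Finset.mem_sdiff.2 ⟨hBD hv, Finset.disjoint_left.1 hBC hv⟩
  · exact fun v hv => Finset.mem_sdiff.2 ⟨Finset.mem_sdiff.2 ⟨hAS v hv,
      Finset.disjoint_left.1 hAD hv⟩, Finset.disjoint_left.1 hAC hv⟩
  · refine (dependsOn_subsetMap q hS hD).mono (Finset.coe_subset.2 fun v hv => ?_)
    rw [Finset.sdiff_union_self_eq_union, Finset.mem_union]
    by_cases hvC : v ∈ C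
    · exact Or.inr hvC
    · rcases Finset.mem_union.1 hv with h | h
      · exact Or.inl h
      · obtain ⟨d, hd, hvd⟩ := mem_pa.1 h
        exact Or.inl (hpa d hd v hvd hvC)
  · refine (dependsOn_subsetMap q hS hD.compl).mono (Finset.coe_subset.2 fun v hv => ?_)
    rw [Finset.sdiff_union_self_eq_union, Finset.mem_union]
    by_cases hvC : v ∈ C
    · exact Or.inr hvC
    · rcases Finset.mem_union.1 hv with h | h
      · exact Or.inl h
      · obtain ⟨d, hd, hvd⟩ := mem_pa.1 h
        obtain ⟨hdS, hdD⟩ := Finset.mem_sdiff.1 hd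
        exact Or.inl (Finset.mem_sdiff.2 ⟨hS hvd hdS, fun hvD => hdD (hch v hvD hvC d hdS hvd)⟩)
  · intro i
    have hset : D \ C ∪ (S \ D) \ C ∪ C = S := by
      ext v
      have h1 := hCS v
      have h2 := @hD.1 v
      simp only [Finset.mem_union, Finset.mem_sdiff]
      tauto
    rw [hset, marg_pMap q hS, subsetMap_mul q hS hD]

lemma pMap_mem_model {q : G.ParamIndex → ℝ} (hq : ∀ x, 0 < G.pMap q x) : G.pMap q ∈ G.model :=
  ⟨hq, sum_pMap q, globalMarkov_pMap hq⟩

/-! ### The parameters of a parametrized vector -/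

lemma qMap_apply (p : (V → Fin 2) → ℝ) {H : Finset V} (hH : H ∈ G.heads) {i : V → Fin 2}
    (hi : ∀ v ∈ H, i v = 0) :
    G.qMap p ⟨⟨H, hH⟩, fun v => i v⟩ = marg p (H ∪ G.tail H)ᶜ i / marg p (G.tail H)ᶜ i := by
  unfold qMap evCondPr
  rw [← evPr_eq_marg, ← evPr_eq_marg]
  congr 2
  · ext x
    rw [Finset.forall_mem_union]
    refine and_congr (forall₂_congr fun v hv => by rw [hi v hv]) ?_
    exact Subtype.forall
  · ext x
    exact Subtype.forall

/-- Every parameter index comes from a vector that vanishes on the head. -/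
lemma exists_eq_paramIndex (k : G.ParamIndex) :
    ∃ i : V → Fin 2, (∀ v ∈ k.1.1, i v = 0) ∧ k = ⟨k.1, fun v => i v⟩ := by
  obtain ⟨⟨H, hH⟩, t⟩ := k
  refine ⟨fun v => if h : v ∈ G.tail H then t ⟨v, h⟩ else 0, fun v hv => ?_, ?_⟩
  · exact dif_neg fun h => (mem_heads.1 hH).disjoint_tail h hv
  · congr 1
    ext1 v
    exact (dif_pos v.2 : (if h : (v : V) ∈ G.tail H then t ⟨v, h⟩ else 0) = _).symm

/-- Numerator and denominator are sums over the same coordinates of the ancestral marginals on an(H)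
and an(H) \ H. Termwise these differ by the parameter of `H`, which is constant because the tail is
held fixed. -/
lemma qMap_pMap {q : G.ParamIndex → ℝ} (hq : ∀ x, 0 < G.pMap q x) : G.qMap (G.pMap q) = q := by
  ext k
  obtain ⟨i, hi, hk⟩ := exists_eq_paramIndex k
  obtain ⟨⟨H, hH⟩, t⟩ := k
  rw [hk, qMap_apply _ hH hi, div_eq_iff (marg_pos hq _ _).ne']
  have hHh := mem_heads.1 hH
  have hS : G.IsAncestral (G.an H) := isAncestral_an H
  have hS' : G.IsAncestral (G.an H \ H) := hS.sdiff fun k hk w hw => hHh.not_dir hk hw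
  have hmem : ∀ v, (v ∈ H → v ∈ G.an H) ∧ (v ∈ G.tail H → v ∈ G.an H) ∧
      (v ∈ G.tail H → v ∉ H) := fun v =>
    ⟨fun h => subset_an H h, fun h => tail_subset_an H h, fun h => hHh.disjoint_tail h⟩
  have h1 : (H ∪ G.tail H)ᶜ = (G.an H \ (H ∪ G.tail H)) ∪ (G.an H)ᶜ := by
    ext v
    have := hmem v
    simp only [Finset.mem_compl, Finset.mem_union, Finset.mem_sdiff]
    grind
  have h2 : (G.tail H)ᶜ = (G.an H \ (H ∪ G.tail H)) ∪ (G.an H \ H)ᶜ := by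
    ext v
    have := hmem v
    simp only [Finset.mem_compl, Finset.mem_union, Finset.mem_sdiff]
    grind
  have hd : Disjoint (G.an H \ (H ∪ G.tail H)) (G.an H \ H)ᶜ := by
    rw [Finset.disjoint_left]
    intro v
    simp only [Finset.mem_compl, Finset.mem_union, Finset.mem_sdiff]
    tauto
  have hd' : Disjoint (G.an H \ (H ∪ G.tail H)) (G.an H)ᶜ :=
    hd.mono_right (Finset.compl_subset_compl.2 Finset.sdiff_subset)
  rw [h1, h2, marg_union hd, marg_union hd']
  unfold marg
  rw [Finset.mul_sum]
  refine Finset.sum_congr rfl fun j hj => ?_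
  have hj' := (Finset.mem_filter.1 hj).2
  change marg _ _ j = _ * marg _ _ j
  have hjH : ∀ v ∈ H, j v = 0 := fun v hv => by
    rw [hj' v (by simp [hv]), hi v hv]
  have ht : (fun v : G.tail H => j v) = fun v : G.tail H => i v :=
    funext fun v => hj' v (by simp [v.2])
  rw [marg_pMap q hS, marg_pMap q hS', subsetMap_an q hH hjH, ht]

/-! ### Distributions in the model are parametrized -/

lemma marg_mul_marg_of_mSep {p : (V → Fin 2) → ℝ} (hp : p ∈ G.model) {A B C : Finset V}
    (hAB : Disjoint A B) (hAC : Disjoint A C) (hBC : Disjoint B C) (hsep : G.MSep A B C)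
    (i : V → Fin 2) : marg p (A ∪ B ∪ C)ᶜ i * marg p Cᶜ i =
      marg p (A ∪ C)ᶜ i * marg p (B ∪ C)ᶜ i := by
  rcases A.eq_empty_or_nonempty with rfl | hA
  · simp [mul_comm]
  rcases B.eq_empty_or_nonempty with rfl | hB
  · simp
  exact (condIndepVars_iff hp.1 A B C).1 (hp.2.2 A B C hAB hAC hBC hA hB hsep) i

/-- The inductive step for an ancestral set generated by a head. -/
lemma marg_eq_subsetMap_of_isHead {p : (V → Fin 2) → ℝ} (hp : p ∈ G.model) {H : Finset V}
    (hH : H ∈ G.heads)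
    (ih : ∀ S ⊂ G.an H, G.IsAncestral S → ∀ i, marg p Sᶜ i = subsetMap (G.qMap p) S i)
    (i : V → Fin 2) : marg p (G.an H)ᶜ i = subsetMap (G.qMap p) (G.an H) i := by
  have hHh := mem_heads.1 hH
  have hS : G.IsAncestral (G.an H) := isAncestral_an H
  have hS' : G.IsAncestral (G.an H \ H) := hS.sdiff fun k hk w hw => hHh.not_dir hk hw
  have hmem : ∀ v, (v ∈ H → v ∈ G.an H) ∧ (v ∈ G.tail H → v ∈ G.an H) ∧
      (v ∈ G.tail H → v ∉ H) := fun v =>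
    ⟨fun h => subset_an H h, fun h => tail_subset_an H h, fun h => hHh.disjoint_tail h⟩
  -- Given its tail, `H` is separated from the rest of an(H), so the an(H)-marginal is q_H times the
  -- marginal on an(H) \ H.
  have hzero : ∀ x : V → Fin 2, (∀ v ∈ H, x v = 0) →
      marg p (G.an H)ᶜ x = subsetMap (G.qMap p) (G.an H) x := by
    intro x hx
    have hss : G.an H \ H ⊂ G.an H := by
      obtain ⟨v, hv⟩ := hHh.1
      exact Finset.sdiff_ssubset (subset_an H) ⟨v, hv⟩
    have hdis : ∀ v, v ∈ G.dis (G.an H) H → v ∈ H ∨ v ∈ G.tail H := fun v hv => by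
      by_cases h : v ∈ H
      · exact Or.inl h
      · exact Or.inr (Finset.mem_union_left _ (Finset.mem_sdiff.2 ⟨hv, h⟩))
    have hsep : G.MSep H ((G.an H \ H) \ G.tail H) (G.tail H) := by
      refine mSep_of_isBiClosed hS (fun v => ?_) (isBiClosed_dis (G.an H) H) ?_ ?_
        (fun a ha w hw => hHh.not_dir ha hw) IsHead.subset_dis
      · have := hmem v
        simp only [Finset.mem_sdiff]
        grind
      · rw [Finset.disjoint_left]
        intro v hv
        have := hdis v hv
        simp only [Finset.mem_sdiff]
        tauto
      · rw [Finset.disjoint_left]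
        intro v hv hv'
        exact (Finset.mem_sdiff.1 hv').2 (Finset.mem_union_right _ hv)
    have hci := marg_mul_marg_of_mSep hp
      (Finset.disjoint_left.2 fun v h1 h2 => (Finset.mem_sdiff.1 (Finset.mem_sdiff.1 h2).1).2 h1)
      (Finset.disjoint_right.2 fun v => (hmem v).2.2) Finset.sdiff_disjoint hsep x
    have e1 : H ∪ (G.an H \ H) \ G.tail H ∪ G.tail H = G.an H := by
      ext v
      have := hmem v
      simp only [Finset.mem_union, Finset.mem_sdiff]
      grind
    have e2 : (G.an H \ H) \ G.tail H ∪ G.tail H = G.an H \ H := by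
      ext v
      have := hmem v
      simp only [Finset.mem_union, Finset.mem_sdiff]
      grind
    rw [e1, e2] at hci
    rw [subsetMap_an _ hH hx, qMap_apply p hH hx, ← ih _ hss hS' x, div_mul_eq_mul_div,
      eq_div_iff (marg_pos hp.1 _ _).ne', hci]
  -- Induction on the set where `x` may be nonzero on `H`: the value at `x v = 1` is the marginal
  -- without `v`, known by `ih`, minus the value at `x v = 0`.
  have key : ∀ K ⊆ H, ∀ x : V → Fin 2, (∀ v ∈ H, v ∉ K → x v = 0) →
      marg p (G.an H)ᶜ x = subsetMap (G.qMap p) (G.an H) x := by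
    intro K
    induction K using Finset.induction_on with
    | empty => exact fun _ x hx => hzero x fun v hv => hx v hv (Finset.notMem_empty v)
    | insert v K hvK ihK =>
      intro hK x hx
      have hvH : v ∈ H := hK (Finset.mem_insert_self v K)
      have hvS : v ∈ G.an H := subset_an H hvH
      have h0 := ihK ((Finset.subset_insert v K).trans hK) (Function.update x v 0) (by
        intro w hw hwK
        by_cases h : w = v
        · subst h
          simp
        · rw [Function.update_of_ne h]
          exact hx w hw (by simp [h, hwK]))
      rcases Fin.exists_fin_two.1 ⟨x v, rfl⟩ with hxv | hxv
      · rwa [← hxv, Function.update_eq_self] at h0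
      · have hch : ∀ w ∈ G.an H, ¬ G.dir v w := fun w hw => hHh.not_dir hvH hw
        have hanc : G.IsAncestral ((G.an H).erase v) := by
          rw [Finset.erase_eq]
          exact hS.sdiff fun k hk => by rwa [Finset.mem_singleton.1 hk]
        have h1 := ih _ (Finset.erase_ssubset hvS) hanc x
        have h2 := subsetMap_update (G.qMap p) (S := (G.an H).erase v) (v := v)
          (by rwa [Finset.insert_erase hvS]) (Finset.notMem_erase v _)
          (by rwa [Finset.insert_erase hvS]) x
        rw [Finset.insert_erase hvS] at h2
        rw [Finset.compl_erase, marg_insert (by simpa using hvS), ← h2, h0] at h1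
        have h3 : Function.update x v 1 = x := by rw [← hxv, Function.update_eq_self]
        rw [h3] at h1
        exact add_left_cancel h1
  exact key H Finset.Subset.rfl i fun v hv hv' => absurd hv hv'

/-- The inductive step for an ancestral set whose barren vertices lie in several districts. -/
lemma marg_eq_subsetMap_of_isBiClosed {p : (V → Fin 2) → ℝ} (hp : p ∈ G.model)
    {S D : Finset V} (hS : G.IsAncestral S) (hD : G.IsBiClosed S D) {v w : V}
    (hv : v ∈ G.barren S) (hvD : v ∈ D) (hw : w ∈ G.barren S) (hwD : w ∉ D)
    (ih : ∀ T ⊂ S, G.IsAncestral T → ∀ i, marg p Tᶜ i = subsetMap (G.qMap p) T i)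
    (i : V → Fin 2) : marg p Sᶜ i = subsetMap (G.qMap p) S i := by
  set q := G.qMap p
  have hbS := barren_subset (G := G) S
  have hch : ∀ k ∈ G.barren S, ∀ u ∈ S, ¬ G.dir k u := fun k hk u hu =>
    not_dir_of_mem_barren hk hu
  obtain ⟨K, hK⟩ : ∃ K, K = G.barren S ∩ D := ⟨_, rfl⟩
  obtain ⟨L, hL⟩ : ∃ L, L = G.barren S \ D := ⟨_, rfl⟩
  have hKb : K ⊆ G.barren S := hK ▸ Finset.inter_subset_left
  have hLb : L ⊆ G.barren S := hL ▸ Finset.sdiff_subset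
  have hKD : K ⊆ D := hK ▸ Finset.inter_subset_right
  have hvK : v ∈ K := hK ▸ Finset.mem_inter.2 ⟨hv, hvD⟩
  have hwL : w ∈ L := hL ▸ Finset.mem_sdiff.2 ⟨hw, hwD⟩
  have hLD : Disjoint D L := hL ▸ Finset.disjoint_sdiff
  have hmem : ∀ u, (u ∈ D → u ∈ S) ∧ (u ∈ K → u ∈ D) ∧ (u ∈ L → u ∈ S) ∧ (u ∈ D → u ∉ L) :=
    fun u => ⟨fun h => hD.1 h, fun h => hKD h, fun h => hbS (hLb h),
      fun h => Finset.disjoint_left.1 hLD h⟩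
  have sub : ∀ K' ⊆ S, K'.Nonempty → S \ K' ⊂ S := fun K' h h' => Finset.sdiff_ssubset h h'
  have hancK : G.IsAncestral (S \ K) := hS.sdiff fun k hk => hch k (hKb hk)
  have hancL : G.IsAncestral (S \ L) := hS.sdiff fun k hk => hch k (hLb hk)
  have hKL : K ∪ L ⊆ G.barren S := Finset.union_subset hKb hLb
  have hancKL : G.IsAncestral (S \ (K ∪ L)) := hS.sdiff fun k hk => hch k (hKL hk)
  have hDL : G.IsBiClosed (S \ L) D := ⟨fun u hu => by have := hmem u; grind,
    fun a ha b hb => hD.2 a ha b (Finset.mem_sdiff.1 hb).1⟩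
  have hDK : G.IsBiClosed (S \ K) (D \ K) := ⟨Finset.sdiff_subset_sdiff hD.1 Finset.Subset.rfl,
    fun a ha b hb hab => Finset.mem_sdiff.2 ⟨hD.2 a (Finset.mem_sdiff.1 ha).1 b
      (Finset.mem_sdiff.1 hb).1 hab, (Finset.mem_sdiff.1 hb).2⟩⟩
  have hDKL : G.IsBiClosed (S \ (K ∪ L)) (D \ K) := ⟨fun u hu => by have := hmem u; grind,
    fun a ha b hb => hDK.2 a ha b (by grind)⟩
  -- All four sets are built from the pieces `D`, `D \ K`, `S \ D` and `(S \ L) \ D`. Hence the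
  -- functions of `S` and `S \ (K ∪ L)` multiply to the same product as those of `S \ K` and `S \
  -- L`, just as the independence says for the marginals.
  have f0 := subsetMap_mul q hS hD i
  have f1 := subsetMap_mul q hancK hDK i
  have f2 := subsetMap_mul q hancL hDL i
  have f3 := subsetMap_mul q hancKL hDKL i
  have e1 : (S \ K) \ (D \ K) = S \ D := by ext u; have := hmem u; grind
  have e3 : (S \ (K ∪ L)) \ (D \ K) = (S \ L) \ D := by ext u; have := hmem u; grind
  rw [e1] at f1
  rw [e3] at f3
  rw [← ih _ (sub K (hKb.trans hbS) ⟨v, hvK⟩) hancK] at f1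
  rw [← ih _ (sub L (hLb.trans hbS) ⟨w, hwL⟩) hancL] at f2
  rw [← ih _ (sub _ (hKL.trans hbS) ⟨v, Finset.mem_union_left _ hvK⟩) hancKL] at f3
  have hsep : G.MSep K L (S \ (K ∪ L)) := by
    refine mSep_of_isBiClosed hS (fun u => ?_) hD hLD ?_ (fun a ha => hch a (hKb ha)) hKD
    · have := hmem u
      grind
    · rw [Finset.disjoint_left]
      intro u hu huL
      obtain ⟨d, hd, hud⟩ := mem_pa.1 hu
      exact hch u (hLb huL) d (hD.1 hd) hud
  have hci := marg_mul_marg_of_mSep hp (hLD.mono_left hKD)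
    (Finset.disjoint_left.2 fun u h1 h2 =>
      (Finset.mem_sdiff.1 h2).2 (Finset.mem_union_left _ h1))
    (Finset.disjoint_left.2 fun u h1 h2 =>
      (Finset.mem_sdiff.1 h2).2 (Finset.mem_union_right _ h1)) hsep i
  have g1 : K ∪ L ∪ S \ (K ∪ L) = S := Finset.union_sdiff_of_subset (hKL.trans hbS)
  have g2 : K ∪ S \ (K ∪ L) = S \ L := by ext u; have := hmem u; grind
  have g3 : L ∪ S \ (K ∪ L) = S \ K := by ext u; have := hmem u; grind
  rw [g1, g2, g3] at hci
  have hpos := (marg_pos hp.1 (S \ (K ∪ L))ᶜ i).ne'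
  refine mul_right_cancel₀ hpos ?_
  rw [hci, f0, f1, f2, f3]
  ring

/-- The ancestral marginals of a distribution in the model. -/
lemma marg_eq_subsetMap {p : (V → Fin 2) → ℝ} (hp : p ∈ G.model) (S : Finset V)
    (hS : G.IsAncestral S) (i : V → Fin 2) : marg p Sᶜ i = subsetMap (G.qMap p) S i := by
  induction S using Finset.strongInduction generalizing i with
  | _ S ih =>
    rcases S.eq_empty_or_nonempty with rfl | ⟨u, hu⟩
    · rw [Finset.compl_empty, marg_univ, subsetMap_empty, hp.2.1]
    have han : G.an (G.barren S) = S := by rw [an_barren, hS.an_eq]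
    by_cases hH : G.IsHead (G.barren S)
    · have := marg_eq_subsetMap_of_isHead hp (mem_heads.2 hH) (by rwa [han]) i
      rwa [han] at this
    · obtain ⟨b, hb, -⟩ := exists_mem_barren (G := G) hu
      have : ¬ ∀ v ∈ G.barren S, G.barren S ⊆ G.dis (G.an (G.barren S)) {v} := fun h =>
        hH ⟨⟨b, hb⟩, barren_barren S, h⟩
      push Not at this
      obtain ⟨v, hv, hsub⟩ := this
      obtain ⟨w, hw, hwD⟩ := Finset.not_subset.1 hsub
      rw [han] at hwD
      have hvS := barren_subset _ hv
      exact marg_eq_subsetMap_of_isBiClosed hp hS (isBiClosed_dis S {v}) hv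
        (mem_dis.2 ⟨hvS, v, Finset.mem_singleton_self v, hvS, Relation.ReflTransGen.refl⟩)
        hw hwD ih i

lemma pMap_qMap {p : (V → Fin 2) → ℝ} (hp : p ∈ G.model) : G.pMap (G.qMap p) = p := by
  ext i
  rw [pMap_eq_subsetMap, ← marg_eq_subsetMap hp _ isAncestral_univ, Finset.compl_univ, marg_empty]

lemma validParams_eq : G.validParams = {q | ∀ x, 0 < G.pMap q x} := by
  ext q
  constructor
  · rintro ⟨p, hp, rfl⟩ x
    rw [pMap_qMap hp]
    exact hp.1 x
  · exact fun hq => ⟨_, pMap_mem_model hq, qMap_pMap hq⟩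

/-- The uniform distribution factorizes trivially. A curved exponential family needs a non-empty
parameter set. -/
lemma model_nonempty : G.model.Nonempty := by
  have hc : (0 : ℝ) < (Fintype.card (V → Fin 2) : ℝ)⁻¹ := by positivity
  refine ⟨fun _ => (Fintype.card (V → Fin 2) : ℝ)⁻¹, fun _ => hc, by simp, ?_⟩
  intro A B C hAB hAC hBC _ _ _
  refine condIndepVars_of_factorization (fun _ => hc) (U := Aᶜ \ C) (R := A)
    (g := fun _ => (Fintype.card (V → Fin 2) : ℝ)⁻¹) (h := fun _ => 1) ?_
    Finset.sdiff_disjoint hAC ?_ Finset.Subset.rfl ?_ ?_ ?_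
  · exact (disjoint_compl_left (a := A)).mono_left Finset.sdiff_subset
  · exact fun v hv => Finset.mem_sdiff.2 ⟨Finset.mem_compl.2 (Finset.disjoint_right.1 hAB hv),
      Finset.disjoint_left.1 hBC hv⟩
  · exact (dependsOn_const _).mono (Set.empty_subset _)
  · exact (dependsOn_const _).mono (Set.empty_subset _)
  · intro i
    have : (Aᶜ \ C ∪ A ∪ C)ᶜ = ∅ := by
      ext v
      simp only [Finset.mem_compl, Finset.mem_union, Finset.mem_sdiff, Finset.notMem_empty]
      tauto
    rw [this, marg_empty, mul_one]

end Model

end ADMG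

/-! ### Ranks of Jacobians and embedding into the saturated exponential family. -/

section Analysis

lemma evPr_pos {X : Type*} [Fintype X] {p : X → ℝ} (hp : ∀ x, 0 < p x) {E : X → Prop} {x : X}
    (hx : E x) : 0 < evPr p E := by
  classical
  exact Finset.sum_pos (fun x _ => hp x) ⟨x, Finset.mem_filter.2 ⟨Finset.mem_univ _, hx⟩⟩

/-! ### Jacobians of inverse maps -/

/-- If `g` is a local left inverse of `f`, then both Jacobians have full rank. -/
lemma rank_jacobian_of_leftInverse {ι κ : Type*} [Fintype ι] [DecidableEq ι] [Fintype κ]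
    [DecidableEq κ] {f : (ι → ℝ) → (κ → ℝ)} {g : (κ → ℝ) → (ι → ℝ)} {x : ι → ℝ}
    (hf : DifferentiableAt ℝ f x) (hg : DifferentiableAt ℝ g (f x))
    (h : ∀ᶠ y in nhds x, g (f y) = y) :
    (jacobian f x).rank = Fintype.card ι ∧ (jacobian g (f x)).rank = Fintype.card ι := by
  have hmul : jacobian g (f x) * jacobian f x = 1 := by
    unfold jacobian
    rw [← LinearMap.toMatrix'_comp, ← LinearMap.toMatrix'_id]
    congr 1
    have h1 : fderiv ℝ (g ∘ f) x = ContinuousLinearMap.id ℝ (ι → ℝ) := by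
      have : (g ∘ f) =ᶠ[nhds x] id := h
      rw [this.fderiv_eq, fderiv_id]
    rw [fderiv_comp x hg hf] at h1
    exact congrArg ContinuousLinearMap.toLinearMap h1
  have h1 : (1 : Matrix ι ι ℝ).rank = Fintype.card ι := Matrix.rank_one
  constructor
  · refine le_antisymm (Matrix.rank_le_card_width _) ?_
    rw [← h1, ← hmul]
    exact Matrix.rank_mul_le_right _ _
  · refine le_antisymm (Matrix.rank_le_card_height _) ?_
    rw [← h1, ← hmul]
    exact Matrix.rank_mul_le_left _ _

/-! ### Curved exponential families from smooth parametrizations -/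

lemma expFamily_pos {X : Type*} [Fintype X] {k : ℕ} (T : X → Fin k → ℝ)
    (η : Fin k → ℝ) (x : X) : 0 < expFamily (fun _ => 1) T η x := by
  unfold expFamily
  have : 0 < ∑ y : X, 1 * Real.exp (∑ j, η j * T y j) :=
    Finset.sum_pos (fun y _ => by positivity) ⟨x, Finset.mem_univ x⟩
  positivity

lemma contDiff_expFamily {X : Type*} [Fintype X] {k : ℕ} (T : X → Fin k → ℝ) :
    ContDiff ℝ ∞ (expFamily (fun _ => 1) T) := by
  have hlin : ∀ x : X, ContDiff ℝ ∞ fun η : Fin k → ℝ => 1 * Real.exp (∑ j, η j * T x j) :=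
    fun x => contDiff_const.mul (Real.contDiff_exp.comp
      (ContDiff.sum fun j _ => (contDiff_apply ℝ ℝ j).mul contDiff_const))
  refine contDiff_pi.2 fun x => (hlin x).div (ContDiff.sum fun y _ => hlin y) fun η => ?_
  exact (Finset.sum_pos (fun y _ => by positivity) ⟨x, Finset.mem_univ x⟩).ne'

/-- The indicators of the points other than `x₀` form a sufficient statistic of the saturated
exponential family, whose natural parameters are log odds relative to `x₀`. -/
lemma expFamily_log_odds {X : Type*} [Fintype X] [DecidableEq X] {k : ℕ} {x₀ : X}
    (e : Fin k ≃ {x // x ≠ x₀}) {p : X → ℝ} (hp : ∀ x, 0 < p x) (hsum : ∑ x, p x = 1) :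
    expFamily (fun _ => 1) (fun (x : X) j => if x = (e j : X) then 1 else 0)
      (fun j => Real.log (p (e j)) - Real.log (p x₀)) = p := by
  have hexp : ∀ x : X, (1 : ℝ) * Real.exp (∑ j, (Real.log (p (e j)) - Real.log (p x₀)) *
      (if x = (e j : X) then 1 else 0)) = p x / p x₀ := by
    intro x
    have : ∑ j, (Real.log (p (e j)) - Real.log (p x₀)) * (if x = (e j : X) then (1 : ℝ) else 0) =
        Real.log (p x) - Real.log (p x₀) := by
      by_cases hx : x = x₀
      · subst hx
        rw [sub_self]
        refine Finset.sum_eq_zero fun j _ => ?_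
        rw [if_neg (e j).2.symm, mul_zero]
      · rw [Finset.sum_eq_single (e.symm ⟨x, hx⟩)]
        · simp
        · intro j _ hj
          rw [if_neg, mul_zero]
          intro h
          refine hj (e.injective ?_)
          rw [Equiv.apply_symm_apply]
          exact Subtype.ext h.symm
        · exact fun h => absurd (Finset.mem_univ _) h
    rw [this, one_mul, Real.exp_sub, Real.exp_log (hp x), Real.exp_log (hp x₀)]
  ext x
  unfold expFamily
  simp only [hexp]
  rw [← Finset.sum_div, hsum]
  have := (hp x₀).ne'
  field_simp

/-- A set of strictly positive distributions that is smoothly parametrized by an open set, with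
smooth inverse, is a curved exponential family. -/
lemma isCurvedExponentialFamily_of_parametrization {X ι : Type*} [Fintype X] [Nonempty X]
    [Fintype ι] {Q : Set (ι → ℝ)} {f : (ι → ℝ) → (X → ℝ)} {g : (X → ℝ) → (ι → ℝ)}
    (hQ : IsOpen Q) (hne : Q.Nonempty) (hf : ContDiff ℝ ∞ f)
    (hg : ContDiffOn ℝ ∞ g {p | ∀ x, 0 < p x}) (hgf : ∀ q ∈ Q, g (f q) = q)
    (hpos : ∀ q ∈ Q, ∀ x, 0 < f q x) (hsum : ∀ q ∈ Q, ∑ x, f q x = 1) :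
    IsCurvedExponentialFamily (f '' Q) (Fintype.card ι) := by
  classical
  obtain ⟨x₀⟩ := ‹Nonempty X›
  let e : Fin (Fintype.card {x // x ≠ x₀}) ≃ {x // x ≠ x₀} := (Fintype.equivFin _).symm
  let r : ι ≃ Fin (Fintype.card ι) := Fintype.equivFin ι
  let T : X → Fin (Fintype.card {x // x ≠ x₀}) → ℝ := fun x j => if x = (e j : X) then 1 else 0
  let R : (Fin (Fintype.card ι) → ℝ) → (ι → ℝ) := fun θ i => θ (r i)
  let R' : (ι → ℝ) → (Fin (Fintype.card ι) → ℝ) := fun q j => q (r.symm j)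
  have hR : ContDiff ℝ ∞ R := contDiff_pi.2 fun i => contDiff_apply ℝ ℝ (r i)
  have hR' : ContDiff ℝ ∞ R' := contDiff_pi.2 fun i => contDiff_apply ℝ ℝ (r.symm i)
  have hR'R : ∀ θ, R' (R θ) = θ := fun θ => funext fun j => by simp [R, R']
  have hRR' : ∀ q, R (R' q) = q := fun q => funext fun j => by simp [R, R']
  let η : (Fin (Fintype.card ι) → ℝ) → (Fin (Fintype.card {x // x ≠ x₀}) → ℝ) :=
    fun θ j => Real.log (f (R θ) (e j)) - Real.log (f (R θ) x₀)
  -- A left inverse of `η` on the parameter set, smooth everywhere since members of the family are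
  -- positive. It yields both the embedding and the rank.
  let L : (Fin (Fintype.card {x // x ≠ x₀}) → ℝ) → (Fin (Fintype.card ι) → ℝ) :=
    fun ν => R' (g (expFamily (fun _ => 1) T ν))
  have hexp : ∀ θ ∈ R ⁻¹' Q, expFamily (fun _ => 1) T (η θ) = f (R θ) := fun θ hθ =>
    expFamily_log_odds e (hpos _ hθ) (hsum _ hθ)
  have hLη : ∀ θ ∈ R ⁻¹' Q, L (η θ) = θ := fun θ hθ => by
    change R' (g (expFamily (fun _ => 1) T (η θ))) = θ
    rw [hexp θ hθ, hgf _ hθ, hR'R]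
  have hL : ContDiff ℝ ∞ L := hR'.comp
    (contDiffOn_univ.1 (hg.comp (contDiff_expFamily T).contDiffOn fun ν _ => expFamily_pos T ν))
  have hΘ : IsOpen (R ⁻¹' Q) := hQ.preimage hR.continuous
  have hcoord : ∀ x, ContDiff ℝ ∞ fun θ => f (R θ) x := fun x =>
    (contDiff_pi.1 (hf.comp hR)) x
  have hη : ContDiffOn ℝ ∞ η (R ⁻¹' Q) := contDiffOn_pi.2 fun j =>
    ((hcoord _).contDiffOn.log fun θ hθ => (hpos _ hθ _).ne').sub
      ((hcoord _).contDiffOn.log fun θ hθ => (hpos _ hθ _).ne')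
  refine ⟨_, fun _ => 1, T, fun _ => one_pos, ?_, R ⁻¹' Q, η, hΘ, ?_, hη, ?_, ?_, ?_⟩
  · intro c₀ c h
    have h0 : c₀ = 0 := by
      have h1 := h x₀
      rwa [Finset.sum_eq_zero, add_zero] at h1
      intro j _
      simp only [T]
      rw [if_neg (e j).2.symm, mul_zero]
    ext j
    have h1 := h (e j)
    rw [h0, zero_add, Finset.sum_eq_single j] at h1
    · simpa [T] using h1
    · intro j' _ hj'
      simp only [T]
      rw [if_neg, mul_zero]
      exact fun h => hj' (e.injective (Subtype.ext h)).symm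
    · exact fun h => absurd (Finset.mem_univ _) h
  · obtain ⟨q, hq⟩ := hne
    exact ⟨R' q, by rwa [Set.mem_preimage, hRR']⟩
  · refine Topology.IsEmbedding.of_comp (g := L) hη.continuousOn.domRestrict hL.continuous ?_
    have : L ∘ (fun θ : R ⁻¹' Q => η θ) = Subtype.val := funext fun θ => hLη θ θ.2
    rw [this]
    exact Topology.IsEmbedding.subtypeVal
  · intro θ hθ
    have hnhds := hΘ.mem_nhds hθ
    have := (rank_jacobian_of_leftInverse (f := η) (g := L) (x := θ)
      ((hη.contDiffAt hnhds).differentiableAt (by simp))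
      (hL.differentiable (by simp) _) (Filter.mem_of_superset hnhds hLη)).1
    rwa [Fintype.card_fin] at this
  · ext p
    constructor
    · rintro ⟨q, hq, rfl⟩
      have hq' : R' q ∈ R ⁻¹' Q := by rwa [Set.mem_preimage, hRR']
      exact ⟨R' q, hq', by simp only [hexp _ hq', hRR']⟩
    · rintro ⟨θ, hθ, rfl⟩
      exact ⟨R θ, hθ, (hexp θ hθ).symm⟩

end Analysis

namespace ADMG

/-! ### Multilinearity, smoothness and openness. -/

section Smooth

variable {V : Type*} [Fintype V] [DecidableEq V] {G : ADMG V}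

lemma card_paramIndex :
    Fintype.card G.ParamIndex = ∑ H ∈ G.heads, Fintype.card (G.tail H → Fin 2) := by
  rw [Fintype.card_sigma]
  exact Finset.sum_coe_sort G.heads fun H => Fintype.card (G.tail H → Fin 2)

/-- Each coordinate of `pMap` is a polynomial of degree at most one in every variable. -/
lemma exists_mvPolynomial_pMap (i : V → Fin 2) : ∃ F : MvPolynomial G.ParamIndex ℝ,
    (∀ k, F.degreeOf k ≤ 1) ∧ ∀ q, G.pMap q i = MvPolynomial.eval q F := by
  classical
  refine ⟨∑ C : Finset V with zeros i ⊆ C, MvPolynomial.C ((-1 : ℝ) ^ (C \ zeros i).card) *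
    ∏ H : G.heads with H.1 ∈ G.partition C, MvPolynomial.X ⟨H, fun v => i v⟩, fun k => ?_,
    fun q => by simp [pMap, map_sum, map_prod]⟩
  refine (MvPolynomial.degreeOf_sum_le _ _ _).trans (Finset.sup_le fun C _ => ?_)
  refine (MvPolynomial.degreeOf_C_mul_le _ _ _).trans
    ((MvPolynomial.degreeOf_prod_le _ _ _).trans ?_)
  simp only [MvPolynomial.degreeOf_X]
  -- The degree in `k` is bounded by the number of heads of [C] whose variable is `k`, and `k`
  -- determines its head.
  rw [← Finset.card_filter, Finset.card_le_one]
  intro H hH H' hH'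
  have h1 := (Finset.mem_filter.1 hH).2
  have h2 := (Finset.mem_filter.1 hH').2
  exact congrArg Sigma.fst (h1.symm.trans h2)

lemma contDiff_pMap : ContDiff ℝ ∞ G.pMap :=
  contDiff_pi.2 fun _ => ContDiff.sum fun _ _ => contDiff_const.mul
    (contDiff_prod fun _ _ => contDiff_apply ℝ ℝ _)

lemma contDiffOn_qMap : ContDiffOn ℝ ∞ G.qMap {p | ∀ x, 0 < p x} := by
  have hev : ∀ E : (V → Fin 2) → Prop, ContDiff ℝ ∞ fun p => evPr p E := fun E =>
    ContDiff.sum fun x _ => contDiff_apply ℝ ℝ x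
  refine contDiffOn_pi.2 fun k => (hev _).contDiffOn.div (hev _).contDiffOn fun p hp => ?_
  obtain ⟨i, -, hk⟩ := exists_eq_paramIndex k
  refine (evPr_pos hp (x := i) ?_).ne'
  rw [hk]
  exact fun _ => rfl

lemma isOpen_setOf_pos {X : Type*} [Finite X] : IsOpen {p : X → ℝ | ∀ x, 0 < p x} := by
  simp only [Set.ofPred_forall]
  exact isOpen_iInter_of_finite fun x => isOpen_lt continuous_const (continuous_apply x)

lemma isOpen_validParams : IsOpen G.validParams := by
  rw [validParams_eq]
  exact isOpen_setOf_pos.preimage contDiff_pMap.continuous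

lemma invOn_qMap_pMap : Set.InvOn G.qMap G.pMap G.validParams G.model :=
  ⟨fun q hq => qMap_pMap (by rwa [validParams_eq] at hq), fun _ hp => pMap_qMap hp⟩

lemma mapsTo_pMap : Set.MapsTo G.pMap G.validParams G.model := fun q hq =>
  pMap_mem_model (by rwa [validParams_eq] at hq)

lemma rank_jacobian_pMap_qMap {q : G.ParamIndex → ℝ} (hq : q ∈ G.validParams) :
    (jacobian G.pMap q).rank = Fintype.card G.ParamIndex ∧
      (jacobian G.qMap (G.pMap q)).rank = Fintype.card G.ParamIndex := by
  have hopen : {p : (V → Fin 2) → ℝ | ∀ x, 0 < p x} ∈ nhds (G.pMap q) :=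
    isOpen_setOf_pos.mem_nhds (mapsTo_pMap hq).1
  exact rank_jacobian_of_leftInverse (contDiff_pMap.differentiable (by simp) _)
    ((contDiffOn_qMap.contDiffAt hopen).differentiableAt (by simp))
    (Filter.mem_of_superset (isOpen_validParams.mem_nhds hq) invOn_qMap_pMap.1)

lemma isCurvedExponentialFamily_model :
    IsCurvedExponentialFamily G.model (Fintype.card G.ParamIndex) := by
  have himage : G.pMap '' G.validParams = G.model :=
    (invOn_qMap_pMap.bijOn mapsTo_pMap (Set.mapsTo_image _ _)).image_eq
  rw [← himage]
  exact isCurvedExponentialFamily_of_parametrization isOpen_validParams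
    (model_nonempty.image _) contDiff_pMap contDiffOn_qMap invOn_qMap_pMap.1
    (fun q hq => (mapsTo_pMap hq).1) fun q _ => sum_pMap q

end Smooth

end ADMG

theorem mainTheorem4 {V : Type*} [Fintype V] [DecidableEq V] (G : ADMG V) (d : ℕ)
    (hd : d = ∑ H ∈ G.heads, Fintype.card (G.tail H → Fin 2)) :
    -- the dimension formula
    d = ∑ H ∈ G.heads, 2 ^ (G.tail H).card ∧
    -- the parameter set is open
    IsOpen G.validParams ∧
    -- `q ↦ p(q)` is a bijection from the valid parameters onto the model, with inverse `p ↦ q(p)`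
    Set.BijOn G.pMap G.validParams G.model ∧
    Set.BijOn G.qMap G.model G.validParams ∧
    Set.InvOn G.qMap G.pMap G.validParams G.model ∧
    -- `q ↦ p(q)` is multilinear, hence smooth
    (∀ i : V → Fin 2, ∃ F : MvPolynomial G.ParamIndex ℝ,
      (∀ k, F.degreeOf k ≤ 1) ∧ ∀ q, G.pMap q i = MvPolynomial.eval q F) ∧
    ContDiff ℝ ∞ G.pMap ∧
    -- the inverse is smooth, on the open set of all positive vectors, which contains the model
    ContDiffOn ℝ ∞ G.qMap {p | ∀ x, 0 < p x} ∧
    -- both Jacobians have full rank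
    (∀ q ∈ G.validParams, (jacobian G.pMap q).rank = d) ∧
    (∀ p ∈ G.model, (jacobian G.qMap p).rank = d) ∧
    -- the model is a curved exponential family
    IsCurvedExponentialFamily G.model d := by
  have hcard : Fintype.card G.ParamIndex = d := ADMG.card_paramIndex.trans hd.symm
  have hinv := ADMG.invOn_qMap_pMap (G := G)
  refine ⟨by simpa using hd, ADMG.isOpen_validParams,
    hinv.bijOn ADMG.mapsTo_pMap (Set.mapsTo_image _ _),
    hinv.symm.bijOn (Set.mapsTo_image _ _) ADMG.mapsTo_pMap, hinv,
    ADMG.exists_mvPolynomial_pMap, ADMG.contDiff_pMap, ADMG.contDiffOn_qMap,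
    fun q hq => hcard ▸ (ADMG.rank_jacobian_pMap_qMap hq).1, fun p hp => ?_,
    hcard ▸ ADMG.isCurvedExponentialFamily_model⟩
  -- Every point of the model is p(q) at q = q(p), where the rank is known.
  have := (ADMG.rank_jacobian_pMap_qMap (Set.mem_image_of_mem G.qMap hp)).2
  rwa [ADMG.pMap_qMap hp, hcard] at this
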